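/- **Conventions.** All rational functions have complex coefficients and the time axis is continuous. For a rational matrix $W(s)$ put $W^*(s)=\overline{W(-\bar s)}^{\top}$, and write $$\left[\begin{array}{c|c}A&B\\\hline C&D\end{array}\right]:=C(sI-A)^{-1}B+D .$$ A *rational spectral density* is a square rational matrix $\Phi(s)$ which has no poles on the imaginary axis (including $\infty$) and is Hermitian positive semidefinite at each point of that axis. $W$ is a *spectral factor* of $\Phi$ if $\Phi=WW^*$. A point $\alpha\in\mathbb C$ at which $W$ is analytic is a *zero* of $W$ if $W(\alpha)v=0$ for some vector $v\ne0$. $W$ is *minimum-phase* if all its poles (on the Riemann sphere, so that $W$ is proper) lie in the open left half plane and all its zeros lie in the closed left half plane. A realization is *minimal* if no realization of the same rational matrix has a smaller state dimension. **Theorem.** Let $\Phi(s)$ be an $(m+p)\times(m+p)$ rational spectral density of rank $m$, partitioned as $$\Phi=\begin{bmatrix}\Phi_{11}&\Phi_{12}\\\Phi_{21}&\Phi_{22}\end{bmatrix}$$ with $\Phi_{11}$ of size $m\times m$ and rank $m$. Let $H=\Phi_{21}\Phi_{11}^{-1}$, let $G_1$ be an $m\times m$ minimum-phase spectral factor of $\Phi_{11}$,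 and let $$G_1(s)^\top H(s)^\top=\left[\begin{array}{cc|c}A_u&A_{us}&B_u\\0&A_s&B_s\\\hline C_u&C_s&D\end{array}\right]$$ be a minimal realization with complex matrices, where the eigenvalues of $A_u$ lie in the open right half plane and those of $A_s$ lie in the closed left half plane. Then the Lyapunov equation $$A_u^*X+XA_u-C_u^*C_u=0$$ has exactly one solution $X$, and this $X$ is Hermitian and invertible. Put $M=-X^{-1}C_u^*$. An $(m+p)\times m$ rational matrix $W(s)$ is a minimum-phase spectral factor of $\Phi$ of full column rank $m$ if and only if there is a unitary matrix $P\in\mathbb C^{m\times m}$ such that $$W=\begin{bmatrix}G_1Q_1\\W_2\end{bmatrix},\qquad Q_1=\left[\begin{array}{c|c}A_u+MC_u&M\\\hline PC_u&P\end{array}\right]^{\top},\qquad W_2=\left[\begin{array}{cc|c}A_u+MC_u&A_{us}+MC_s&B_u+MD\\0&A_s&B_s\\\hline PC_u&PC_s&PD\end{array}\right]^{\top}.$$ -/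

import Mathlib

open scoped Matrix ComplexOrder

noncomputable section

namespace SpectralFactorization

/-- The conjugation `p ↦ p^*` on polynomials, `p^*(s) = conj (p (-conj s))`: conjugate the
coefficients and substitute `-s` for `s`. -/
def paraConjPoly : Polynomial ℂ →+* Polynomial ℂ :=
  (Polynomial.compRingHom (-Polynomial.X)).comp (Polynomial.mapRingHom (starRingEnd ℂ))

theorem paraConjPoly_eval (p : Polynomial ℂ) (s : ℂ) :
    (paraConjPoly p).eval s = starRingEnd ℂ (p.eval (-starRingEnd ℂ s)) := by
  have h : -s = starRingEnd ℂ (-starRingEnd ℂ s) := by simp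
  simp only [paraConjPoly, RingHom.coe_comp, Function.comp_apply, Polynomial.coe_mapRingHom,
    Polynomial.coe_compRingHom_apply, Polynomial.eval_comp, Polynomial.eval_neg,
    Polynomial.eval_X]
  rw [h, Polynomial.eval_map_apply]

theorem paraConjPoly_injective : Function.Injective paraConjPoly := by
  rw [injective_iff_map_eq_zero]
  intro p hp
  refine Polynomial.funext fun s => ?_
  have h := paraConjPoly_eval p (-starRingEnd ℂ s)
  simpa [hp] using h.symm

/-- The para-Hermitian conjugation `f ↦ f^*`, `f^*(s) = conj (f (-conj s))`, on scalar rational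
functions. On the imaginary axis `f^*` is the complex conjugate of `f`. -/
def paraConj : RatFunc ℂ →+* RatFunc ℂ :=
  RatFunc.mapRingHom paraConjPoly
    (nonZeroDivisors_le_comap_nonZeroDivisors_of_injective paraConjPoly paraConjPoly_injective)

/-- `W^*(s) = (W (-conj s))ᴴ` for a matrix `W` of rational functions. -/
def paraConjTranspose {ι κ : Type*} (W : Matrix ι κ (RatFunc ℂ)) : Matrix κ ι (RatFunc ℂ) :=
  (W.map paraConj)ᵀ

/-- The value `W(s)` of a rational matrix; meaningful only where `W` has no pole. -/
def evalAt {ι κ : Type*} (s : ℂ) (W : Matrix ι κ (RatFunc ℂ)) : Matrix ι κ ℂ :=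
  W.map (RatFunc.eval (RingHom.id ℂ) s)

/-- `s` is a (finite) pole of some entry of `W`; `denom` is the denominator in lowest terms. -/
def IsPole {ι κ : Type*} (W : Matrix ι κ (RatFunc ℂ)) (s : ℂ) : Prop :=
  ∃ i j, (W i j).denom.IsRoot s

/-- `W` is proper, i.e. has no pole at infinity. -/
def IsProper {ι κ : Type*} (W : Matrix ι κ (RatFunc ℂ)) : Prop :=
  ∀ i j, (W i j).intDegree ≤ 0

/-- `s` is a (right) zero of `W`: `W` is analytic at `s` and `W(s) v = 0` for some `v ≠ 0`. -/
def IsZero {ι κ : Type*} [Fintype κ] (W : Matrix ι κ (RatFunc ℂ)) (s : ℂ) : Prop :=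
  ¬ IsPole W s ∧ ∃ v : κ → ℂ, v ≠ 0 ∧ evalAt s W *ᵥ v = 0

/-- Minimum phase in continuous time: all poles (also on the Riemann sphere, so that `W` is
proper) lie in the open left half plane, and all zeros lie in the closed left half plane. -/
structure IsMinimumPhase {ι κ : Type*} [Fintype κ] (W : Matrix ι κ (RatFunc ℂ)) : Prop where
  proper : IsProper W
  pole_re_neg : ∀ s : ℂ, IsPole W s → s.re < 0
  zero_re_nonpos : ∀ s : ℂ, IsZero W s → s.re ≤ 0

/-- A rational spectral density in continuous time: a square rational matrix without poles on the
extended imaginary axis, Hermitian positive semidefinite at every point of that axis. -/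
structure IsSpectralDensity {ι : Type*} (Φ : Matrix ι ι (RatFunc ℂ)) : Prop where
  proper : IsProper Φ
  not_isPole : ∀ ω : ℝ, ¬ IsPole Φ (ω * Complex.I)
  posSemidef : ∀ ω : ℝ, (evalAt (ω * Complex.I) Φ).PosSemidef

/-- `W` is a spectral factor of `Φ`: `Φ = W W^*`. -/
def IsSpectralFactor {ι κ : Type*} [Fintype κ]
    (Φ : Matrix ι ι (RatFunc ℂ)) (W : Matrix ι κ (RatFunc ℂ)) : Prop :=
  Φ = W * paraConjTranspose W

/-- The rational matrix `C (s I - A)⁻¹ B + D`, written `[A | B; C | D]`. -/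
def transferMatrix {ν ι κ : Type*} [Fintype ν] [DecidableEq ν]
    (A : Matrix ν ν ℂ) (B : Matrix ν κ ℂ) (C : Matrix ι ν ℂ) (D : Matrix ι κ ℂ) :
    Matrix ι κ (RatFunc ℂ) :=
  C.map RatFunc.C * (Matrix.scalar ν RatFunc.X - A.map RatFunc.C)⁻¹ * B.map RatFunc.C +
    D.map RatFunc.C

/-- `(A, B, C, D)` is a minimal realization of `T`: it realizes `T`, and no realization of `T`
has a smaller state dimension. -/
def IsMinimalRealization {ν ι κ : Type*} [Fintype ν] [DecidableEq ν]
    (A : Matrix ν ν ℂ) (B : Matrix ν κ ℂ) (C : Matrix ι ν ℂ) (D : Matrix ι κ ℂ)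
    (T : Matrix ι κ (RatFunc ℂ)) : Prop :=
  transferMatrix A B C D = T ∧
    ∀ (k : ℕ) (A' : Matrix (Fin k) (Fin k) ℂ) (B' : Matrix (Fin k) κ ℂ)
      (C' : Matrix ι (Fin k) ℂ) (D' : Matrix ι κ ℂ),
      transferMatrix A' B' C' D' = T → Fintype.card ν ≤ k

end SpectralFactorization

end

/-! Let `K = [Au + M Cu | M; Cu | 1]` and `T = G₁ᵀ Hᵀ`. The Lyapunov equation with `M = -X⁻¹ Cuᴴ`
reads `X (Au + M Cu) = -Auᴴ X`. Its solution is invertible because a kernel of `X` would contain an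
unobservable eigenvector of `Au`. Hence `Au + M Cu` is similar to `-Auᴴ`, so stable, and `K` is
all-pass (`lyapunov_allPass`).

Existence. The rank condition kills the Schur complement of `Φ₁₁`, so `[G₁; H G₁]` is a spectral
factor, and so is `W₀ = [G₁; H G₁] Kᵀ`. Multiplying `T` by `K` is an output injection
(`outputInjection_mul`), which replaces the antistable block `Au` by `Au + M Cu` and keeps `As`.
Eigenvalues of `As` on the imaginary axis do no harm, since a factor of `Φ` has no poles there. A
zero of `W₀` in the open right half plane would give a vector killed on the left by both `K` and `K
T`, hence an uncontrollable mode of the minimal realization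
(`IsMinimalRealization.eq_zero_of_outputInjection`).

Uniqueness. Any other factor is `W₀ U` with `U` all-pass (`IsSpectralFactor.exists_allPass`). If
both factors are minimum-phase, `U` and `U^*` are analytic in the open right half plane, while `U
U^* = 1` excludes poles on the axis and at infinity. So `U` has no poles at all and is a unitary
constant (`IsMinimumPhase.exists_unitary`). -/

noncomputable section

namespace SpectralFactorization

/-! ### Local rings of rational functions at a finite point and at infinity. -/

section

open Polynomial

/-- The rational functions without a pole at `α`. -/
def regularAt (α : ℂ) : Subring (RatFunc ℂ) where
  carrier := {f | ¬ f.denom.IsRoot α}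
  mul_mem' {f g} hf hg h := by
    rcases root_mul.1 (h.dvd (RatFunc.denom_mul_dvd f g)) with h | h
    exacts [hf h, hg h]
  one_mem' := by simp
  add_mem' {f g} hf hg h := by
    rcases root_mul.1 (h.dvd (RatFunc.denom_add_dvd f g)) with h | h
    exacts [hf h, hg h]
  zero_mem' := by simp
  neg_mem' {f} hf h := by
    refine hf (h.dvd ?_)
    rw [RatFunc.denom_dvd f.denom_ne_zero]
    exact ⟨-f.num, by rw [map_neg, neg_div, RatFunc.num_div_denom]⟩

theorem mem_regularAt {α : ℂ} {f : RatFunc ℂ} : f ∈ regularAt α ↔ f.denom.eval α ≠ 0 := Iff.rfl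

/-- The reduced denominator divides every denominator, so `q` need not be coprime to `p`. -/
theorem mem_regularAt_of_mul {α : ℂ} {f : RatFunc ℂ} (p q : ℂ[X]) (hq : q.eval α ≠ 0)
    (h : f * algebraMap _ _ q = algebraMap _ _ p) : f ∈ regularAt α := by
  have hq0 : q ≠ 0 := by rintro rfl; simp at hq
  intro hr
  refine hq (hr.dvd ((RatFunc.denom_dvd hq0).2 ⟨p, ?_⟩))
  rw [← h, mul_div_cancel_right₀]
  simpa using hq0

theorem algebraMap_mem_regularAt (α : ℂ) (p : ℂ[X]) : algebraMap _ (RatFunc ℂ) p ∈ regularAt α :=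
  mem_regularAt_of_mul p 1 (by simp) (by simp)

theorem C_mem_regularAt (α c : ℂ) : RatFunc.C c ∈ regularAt α := by simp [mem_regularAt]

/-- Evaluation at `α` as a ring homomorphism on the functions regular at `α`. -/
def evalHom (α : ℂ) : regularAt α →+* ℂ where
  toFun f := RatFunc.eval (RingHom.id ℂ) α f
  map_one' := RatFunc.eval_one _ _
  map_zero' := RatFunc.eval_zero _ _
  map_mul' f g := RatFunc.eval_mul _ _ f.2 g.2
  map_add' f g := RatFunc.eval_add _ _ f.2 g.2

theorem eval_mul_denom {α : ℂ} {f : RatFunc ℂ} (hf : f ∈ regularAt α) :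
    f.eval (RingHom.id ℂ) α * f.denom.eval α = f.num.eval α := by
  have : f.denom.eval α ≠ 0 := hf
  rw [RatFunc.eval, eval₂_id, eval₂_id, div_mul_cancel₀ _ this]

theorem inv_mem_regularAt {α : ℂ} {f : RatFunc ℂ} (hf : f ∈ regularAt α)
    (h : f.eval (RingHom.id ℂ) α ≠ 0) : f⁻¹ ∈ regularAt α := by
  have hd : f.denom.eval α ≠ 0 := hf
  have hn : f.num.eval α ≠ 0 := by rw [← eval_mul_denom hf]; exact mul_ne_zero h hd
  have hf0 : f ≠ 0 := by rintro rfl; simp at h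
  exact fun hr => hn (hr.dvd (RatFunc.denom_inv_dvd hf0))

/-- The rational functions without a pole at infinity. -/
def properRing : Subring (RatFunc ℂ) where
  carrier := {f | f.intDegree ≤ 0}
  mul_mem' {f g} hf hg := by
    rcases eq_or_ne f 0 with rfl | hf0
    · simp
    rcases eq_or_ne g 0 with rfl | hg0
    · simp
    exact (RatFunc.intDegree_mul hf0 hg0).trans_le (add_nonpos hf hg)
  one_mem' := by simp
  add_mem' {f g} hf hg := by
    rcases eq_or_ne g 0 with rfl | hg0
    · simpa using hf
    rcases eq_or_ne (f + g) 0 with h | h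
    · simp [h]
    exact (RatFunc.intDegree_add_le hg0 h).trans (max_le hf hg)
  zero_mem' := by simp
  neg_mem' {f} hf := by simpa using hf

theorem mem_properRing {f : RatFunc ℂ} : f ∈ properRing ↔ f.intDegree ≤ 0 := Iff.rfl

theorem C_mem_properRing (c : ℂ) : RatFunc.C c ∈ properRing := by simp [mem_properRing]

/-- A rational function without poles on the Riemann sphere is constant. -/
theorem eq_C_of_regular {f : RatFunc ℂ} (h : ∀ α, f ∈ regularAt α) (hp : f ∈ properRing) :
    ∃ c, f = RatFunc.C c := by
  have hd : f.denom = 1 := by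
    refine (RatFunc.monic_denom f).natDegree_eq_zero.1 ?_
    by_contra hne
    obtain ⟨z, hz⟩ := Complex.exists_root (f := f.denom)
      (natDegree_pos_iff_degree_pos.1 (Nat.pos_of_ne_zero hne))
    exact h z hz
  have hn : f.num.natDegree = 0 := by
    have : f.intDegree ≤ 0 := hp
    rw [RatFunc.intDegree, hd] at this
    simpa using this
  refine ⟨f.num.coeff 0, ?_⟩
  conv_lhs => rw [← RatFunc.num_div_denom f, hd, eq_C_of_natDegree_eq_zero hn]
  simp

/-- A rational function vanishing on the imaginary axis is zero. -/
theorem eq_zero_of_eval_axis {f : RatFunc ℂ} (h : ∀ ω : ℝ, f ∈ regularAt (ω * Complex.I))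
    (h0 : ∀ ω : ℝ, f.eval (RingHom.id ℂ) (ω * Complex.I) = 0) : f = 0 := by
  rw [← RatFunc.num_eq_zero_iff]
  refine eq_zero_of_infinite_isRoot _ (Set.Infinite.mono (s := Set.range fun ω : ℝ => ω * Complex.I)
    ?_ (Set.infinite_range_of_injective fun a b hab => ?_))
  · rintro _ ⟨ω, rfl⟩
    have := eval_mul_denom (h ω)
    rw [h0, zero_mul] at this
    exact this.symm
  · simpa using hab

end

/-! ### Rational matrices with regular entries, and their values. -/

section

open Polynomial

section Entries

variable {K ι κ l : Type*} [Field K] {R : Subring K}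

theorem exists_map_subtype {A : Matrix ι κ K} (hA : ∀ i j, A i j ∈ R) :
    ∃ A' : Matrix ι κ R, A = A'.map R.subtype :=
  ⟨fun i j => ⟨A i j, hA i j⟩, rfl⟩

theorem matrix_mul_mem [Fintype κ] {A : Matrix ι κ K} {B : Matrix κ l K}
    (hA : ∀ i j, A i j ∈ R) (hB : ∀ i j, B i j ∈ R) (i j) : (A * B) i j ∈ R :=
  R.sum_mem fun k _ => R.mul_mem (hA i k) (hB k j)

theorem matrix_det_mem [Fintype ι] [DecidableEq ι] {A : Matrix ι ι K}
    (hA : ∀ i j, A i j ∈ R) : A.det ∈ R := by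
  obtain ⟨A', rfl⟩ := exists_map_subtype hA
  exact (R.subtype.map_det A').symm ▸ (A'.det).2

theorem matrix_inv_mem [Fintype ι] [DecidableEq ι] {A : Matrix ι ι K}
    (hA : ∀ i j, A i j ∈ R) (hdet : A.det⁻¹ ∈ R) (i j) : A⁻¹ i j ∈ R := by
  rw [Matrix.inv_def, Ring.inverse_eq_inv', Matrix.smul_apply, smul_eq_mul]
  refine R.mul_mem hdet ?_
  obtain ⟨A', rfl⟩ := exists_map_subtype hA
  have := R.subtype.map_adjugate A'
  exact (congrFun (congrFun this i) j) ▸ (A'.adjugate i j).2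

end Entries

section Eval

variable {ι κ l : Type*} {α : ℂ}

theorem not_isPole_iff {W : Matrix ι κ (RatFunc ℂ)} :
    ¬ IsPole W α ↔ ∀ i j, W i j ∈ regularAt α := by
  simp only [IsPole, not_exists]; rfl

/-- `RatFunc.eval` is multiplicative only away from poles, so the entries are lifted to `regularAt
α`, where `evalHom` is a ring homomorphism. -/
theorem evalAt_mul [Fintype κ] {A : Matrix ι κ (RatFunc ℂ)} {B : Matrix κ l (RatFunc ℂ)}
    (hA : ∀ i j, A i j ∈ regularAt α) (hB : ∀ i j, B i j ∈ regularAt α) :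
    evalAt α (A * B) = evalAt α A * evalAt α B := by
  obtain ⟨A, rfl⟩ := exists_map_subtype hA
  obtain ⟨B, rfl⟩ := exists_map_subtype hB
  rw [← Matrix.map_mul]
  exact Matrix.map_mul (f := evalHom α)

theorem evalAt_add {A B : Matrix ι κ (RatFunc ℂ)}
    (hA : ∀ i j, A i j ∈ regularAt α) (hB : ∀ i j, B i j ∈ regularAt α) :
    evalAt α (A + B) = evalAt α A + evalAt α B := by
  ext i j
  exact RatFunc.eval_add _ _ (hA i j) (hB i j)

theorem evalAt_C (α : ℂ) (A : Matrix ι κ ℂ) : evalAt α (A.map RatFunc.C) = A := by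
  ext i j
  simp [evalAt]

theorem evalAt_one [DecidableEq ι] (α : ℂ) : evalAt α (1 : Matrix ι ι (RatFunc ℂ)) = 1 := by
  rw [evalAt, Matrix.map_one _ (RatFunc.eval_zero _ _) (RatFunc.eval_one _ _)]

theorem eval_det [Fintype ι] [DecidableEq ι] {A : Matrix ι ι (RatFunc ℂ)}
    (hA : ∀ i j, A i j ∈ regularAt α) :
    A.det.eval (RingHom.id ℂ) α = (evalAt α A).det := by
  obtain ⟨A, rfl⟩ := exists_map_subtype hA
  have h := (regularAt α).subtype.map_det A
  have h' := (evalHom α).map_det A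
  refine Eq.trans ?_ h'
  exact congrArg (RatFunc.eval (RingHom.id ℂ) α) h.symm

theorem inv_regular [Fintype ι] [DecidableEq ι] {A : Matrix ι ι (RatFunc ℂ)}
    (hA : ∀ i j, A i j ∈ regularAt α) (h : (evalAt α A).det ≠ 0) (i j) :
    A⁻¹ i j ∈ regularAt α :=
  matrix_inv_mem hA (inv_mem_regularAt (matrix_det_mem hA) (by rwa [eval_det hA])) i j

theorem det_ne_zero_of_evalAt [Fintype ι] [DecidableEq ι] {A : Matrix ι ι (RatFunc ℂ)}
    (hA : ∀ i j, A i j ∈ regularAt α) (h : (evalAt α A).det ≠ 0) : A.det ≠ 0 := by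
  intro h0
  rw [← eval_det hA, h0] at h
  simp at h

theorem C_entries_regular (α : ℂ) (A : Matrix ι κ ℂ) (i j) :
    A.map RatFunc.C i j ∈ regularAt α := C_mem_regularAt α _

end Eval

/-! ### Resolvents and transfer matrices. -/

section Transfer

variable {ν μ ι κ : Type*} [Fintype ν] [DecidableEq ν] [Fintype μ] [DecidableEq μ]

/-- The pencil `s I - A`. -/
def pencil (A : Matrix ν ν ℂ) : Matrix ν ν (RatFunc ℂ) :=
  Matrix.scalar ν RatFunc.X - A.map RatFunc.C

theorem transferMatrix_eq (A : Matrix ν ν ℂ) (B : Matrix ν κ ℂ) (C : Matrix ι ν ℂ)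
    (D : Matrix ι κ ℂ) : transferMatrix A B C D =
      C.map RatFunc.C * (pencil A)⁻¹ * B.map RatFunc.C + D.map RatFunc.C := rfl

theorem pencil_eq_map (A : Matrix ν ν ℂ) :
    pencil A = A.charmatrix.map (algebraMap ℂ[X] (RatFunc ℂ)) := by
  ext i j
  by_cases h : i = j
  · subst h; simp [pencil]
  · simp [pencil, h]

theorem det_pencil (A : Matrix ν ν ℂ) :
    (pencil A).det = algebraMap ℂ[X] (RatFunc ℂ) A.charpoly := by
  rw [pencil_eq_map, Matrix.charpoly]
  exact ((algebraMap ℂ[X] (RatFunc ℂ)).map_det A.charmatrix).symm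

theorem isUnit_det_pencil (A : Matrix ν ν ℂ) : IsUnit (pencil A).det := by
  rw [det_pencil, isUnit_iff_ne_zero]
  simpa using A.charpoly_monic.ne_zero

theorem pencil_regular (α : ℂ) (A : Matrix ν ν ℂ) (i j) : pencil A i j ∈ regularAt α := by
  rw [pencil_eq_map]
  exact algebraMap_mem_regularAt _ _

theorem evalAt_pencil (α : ℂ) (A : Matrix ν ν ℂ) :
    evalAt α (pencil A) = Matrix.scalar ν α - A := by
  rw [pencil_eq_map]
  ext i j
  change RatFunc.eval (RingHom.id ℂ) α (algebraMap _ _ (A.charmatrix i j)) = _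
  rw [RatFunc.eval_algebraMap]
  by_cases h : i = j
  · subst h; simp
  · simp [h]

theorem det_scalar_sub_ne_zero {α : ℂ} {A : Matrix ν ν ℂ} (h : α ∉ spectrum ℂ A) :
    (Matrix.scalar ν α - A).det ≠ 0 := by
  rw [spectrum.notMem_iff, Matrix.isUnit_iff_isUnit_det, isUnit_iff_ne_zero] at h
  exact h

theorem resolvent_regular {α : ℂ} {A : Matrix ν ν ℂ} (h : α ∉ spectrum ℂ A) (i j) :
    (pencil A)⁻¹ i j ∈ regularAt α :=
  inv_regular (pencil_regular α A) (by rw [evalAt_pencil]; exact det_scalar_sub_ne_zero h) i j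

theorem evalAt_resolvent {α : ℂ} {A : Matrix ν ν ℂ} (h : α ∉ spectrum ℂ A) :
    evalAt α (pencil A)⁻¹ = (Matrix.scalar ν α - A)⁻¹ := by
  symm
  refine Matrix.inv_eq_left_inv ?_
  rw [← evalAt_pencil, ← evalAt_mul (resolvent_regular h) (pencil_regular α A),
    Matrix.nonsing_inv_mul _ (isUnit_det_pencil A), evalAt_one]

theorem transferMatrix_regular {α : ℂ} {A : Matrix ν ν ℂ} (h : α ∉ spectrum ℂ A)
    (B : Matrix ν κ ℂ) (C : Matrix ι ν ℂ) (D : Matrix ι κ ℂ) (i j) :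
    transferMatrix A B C D i j ∈ regularAt α :=
  (regularAt α).add_mem (matrix_mul_mem (matrix_mul_mem (C_entries_regular α C)
    (resolvent_regular h)) (C_entries_regular α B) i j) (C_entries_regular α D i j)

theorem evalAt_transferMatrix {α : ℂ} {A : Matrix ν ν ℂ} (h : α ∉ spectrum ℂ A)
    (B : Matrix ν κ ℂ) (C : Matrix ι ν ℂ) (D : Matrix ι κ ℂ) :
    evalAt α (transferMatrix A B C D) = C * (Matrix.scalar ν α - A)⁻¹ * B + D := by
  have hC := matrix_mul_mem (C_entries_regular α C) (resolvent_regular h)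
  rw [transferMatrix_eq, evalAt_add (matrix_mul_mem hC (C_entries_regular α B))
    (C_entries_regular α D), evalAt_mul hC (C_entries_regular α B),
    evalAt_mul (C_entries_regular α C) (resolvent_regular h), evalAt_resolvent h]
  simp only [evalAt_C]

/-- An adjugate entry is the determinant of the pencil with one row made constant, which still has
the form `det (X • P + Q)`. This crude bound is all that properness of the resolvent needs. -/
theorem natDegree_adjugate_charmatrix_le (A : Matrix ν ν ℂ) (i j) :
    (A.charmatrix.adjugate i j).natDegree ≤ Fintype.card ν := by
  rw [Matrix.adjugate_apply]
  convert natDegree_det_X_add_C_le (Matrix.updateRow 1 j 0) (Matrix.updateRow (-A) j (Pi.single i 1))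
    using 4
  ext a b : 1
  by_cases h : a = j
  · subst h
    by_cases hb : b = i <;> simp [hb]
  · by_cases hb : a = b
    · subst hb
      simp [Matrix.updateRow_ne h, sub_eq_add_neg]
    · simp [Matrix.updateRow_ne h, hb]

theorem resolvent_proper (A : Matrix ν ν ℂ) (i j) : (pencil A)⁻¹ i j ∈ properRing := by
  rw [Matrix.inv_def, Ring.inverse_eq_inv', Matrix.smul_apply, smul_eq_mul, det_pencil,
    pencil_eq_map]
  have : (A.charmatrix.map (algebraMap ℂ[X] (RatFunc ℂ))).adjugate i j =
      algebraMap ℂ[X] (RatFunc ℂ) (A.charmatrix.adjugate i j) :=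
    (congrFun (congrFun ((algebraMap ℂ[X] (RatFunc ℂ)).map_adjugate A.charmatrix) i) j).symm
  rw [this, mem_properRing]
  by_cases h0 : A.charmatrix.adjugate i j = 0
  · simp [h0]
  have hc := A.charpoly_monic.ne_zero
  rw [RatFunc.intDegree_mul (by simpa using hc) (by simpa using h0), RatFunc.intDegree_inv,
    RatFunc.intDegree_polynomial, RatFunc.intDegree_polynomial, A.charpoly_natDegree_eq_dim]
  have := natDegree_adjugate_charmatrix_le A i j
  omega

theorem transferMatrix_proper (A : Matrix ν ν ℂ) (B : Matrix ν κ ℂ) (C : Matrix ι ν ℂ)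
    (D : Matrix ι κ ℂ) (i j) : transferMatrix A B C D i j ∈ properRing :=
  properRing.add_mem (matrix_mul_mem (matrix_mul_mem (fun _ _ => C_mem_properRing _)
    (resolvent_proper A)) (fun _ _ => C_mem_properRing _) i j) (C_mem_properRing _)

theorem map_C_mul {l : Type*} [Fintype κ] (A : Matrix ι κ ℂ) (B : Matrix κ l ℂ) :
    (A * B).map RatFunc.C = A.map RatFunc.C * B.map RatFunc.C := Matrix.map_mul

theorem map_C_add (A B : Matrix ι κ ℂ) :
    (A + B).map RatFunc.C = A.map RatFunc.C + B.map RatFunc.C :=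
  Matrix.map_add _ (map_add _) A B

theorem map_C_one [DecidableEq ι] : (1 : Matrix ι ι ℂ).map RatFunc.C = 1 :=
  Matrix.map_one _ (map_zero _) (map_one _)

theorem map_C_injective : Function.Injective fun A : Matrix ι κ ℂ => A.map RatFunc.C :=
  Matrix.map_injective RatFunc.C_injective

/-- If `V` intertwines `A'` with `A`, it intertwines the resolvents. -/
theorem resolvent_intertwine {A : Matrix ν ν ℂ} {A' : Matrix μ μ ℂ} {V : Matrix ν μ ℂ}
    (h : A * V = V * A') :
    (pencil A)⁻¹ * V.map RatFunc.C = V.map RatFunc.C * (pencil A')⁻¹ := by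
  have hp : pencil A * V.map RatFunc.C = V.map RatFunc.C * pencil A' := by
    rw [pencil, pencil, Matrix.sub_mul, Matrix.mul_sub, ← map_C_mul, ← map_C_mul, h]
    congr 1
    simpa [Matrix.scalar_apply] using by
      ext i j
      simp [Matrix.diagonal_mul, Matrix.mul_diagonal, mul_comm]
  calc (pencil A)⁻¹ * V.map RatFunc.C
      = (pencil A)⁻¹ * (V.map RatFunc.C * pencil A') * (pencil A')⁻¹ := by
        rw [Matrix.mul_assoc, Matrix.mul_assoc (V.map _),
          Matrix.mul_nonsing_inv _ (isUnit_det_pencil A'), Matrix.mul_one]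
    _ = _ := by
        rw [← hp, ← Matrix.mul_assoc, Matrix.nonsing_inv_mul _ (isUnit_det_pencil A),
          Matrix.one_mul]

/-- `V` need not be square: this covers similarity by `X`, restriction to an invariant hyperplane,
and removal of an unreachable block. -/
theorem transferMatrix_intertwine {A : Matrix ν ν ℂ} {A' : Matrix μ μ ℂ} {V : Matrix ν μ ℂ}
    (h : A * V = V * A') (B' : Matrix μ κ ℂ) (C : Matrix ι ν ℂ) (D : Matrix ι κ ℂ) :
    transferMatrix A (V * B') C D = transferMatrix A' B' (C * V) D := by
  rw [transferMatrix_eq, transferMatrix_eq, map_C_mul, map_C_mul, Matrix.mul_assoc,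
    ← Matrix.mul_assoc (pencil A)⁻¹, resolvent_intertwine h]
  simp only [Matrix.mul_assoc]

theorem pencil_transpose (A : Matrix ν ν ℂ) : pencil Aᵀ = (pencil A)ᵀ := by
  rw [pencil, pencil, Matrix.transpose_sub]
  simp [Matrix.scalar_apply, Matrix.transpose_map]

theorem transferMatrix_transpose (A : Matrix ν ν ℂ) (B : Matrix ν κ ℂ) (C : Matrix ι ν ℂ)
    (D : Matrix ι κ ℂ) : (transferMatrix A B C D)ᵀ = transferMatrix Aᵀ Cᵀ Bᵀ Dᵀ := by
  rw [transferMatrix_eq, transferMatrix_eq, pencil_transpose, ← Matrix.transpose_nonsing_inv]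
  simp [Matrix.transpose_mul, Matrix.mul_assoc, Matrix.transpose_map]

theorem mul_transferMatrix {l : Type*} [Fintype ι] (P : Matrix l ι ℂ)
    (A : Matrix ν ν ℂ) (B : Matrix ν κ ℂ) (C : Matrix ι ν ℂ) (D : Matrix ι κ ℂ) :
    transferMatrix A B (P * C) (P * D) = P.map RatFunc.C * transferMatrix A B C D := by
  rw [transferMatrix_eq, transferMatrix_eq, map_C_mul, map_C_mul, Matrix.mul_add]
  simp only [Matrix.mul_assoc]

/-- Output injection: left multiplication by `1 + C (s - A - L C)⁻¹ L`. -/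
theorem outputInjection_mul [Fintype ι] [DecidableEq ι] (A : Matrix ν ν ℂ) (B : Matrix ν κ ℂ)
    (C : Matrix ι ν ℂ) (D : Matrix ι κ ℂ) (L : Matrix ν ι ℂ) :
    transferMatrix (A + L * C) L C 1 * transferMatrix A B C D =
      transferMatrix (A + L * C) (B + L * D) C D := by
  have hp : pencil A = pencil (A + L * C) + L.map RatFunc.C * C.map RatFunc.C := by
    rw [pencil, pencil, map_C_add, map_C_mul]; abel
  have hC : transferMatrix (A + L * C) L C 1 * (C.map RatFunc.C * (pencil A)⁻¹) =
      C.map RatFunc.C * (pencil (A + L * C))⁻¹ := by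
    -- With `F = A + L C`, this is `C + C (s - F)⁻¹ L C = C (s - F)⁻¹ (s - F + L C)`.
    have : transferMatrix (A + L * C) L C 1 * C.map RatFunc.C =
        C.map RatFunc.C * (pencil (A + L * C))⁻¹ * pencil A := by
      rw [hp, Matrix.mul_add, Matrix.nonsing_inv_mul_cancel_right _ _ (isUnit_det_pencil _),
        transferMatrix_eq, map_C_one, Matrix.add_mul, Matrix.one_mul, add_comm,
        Matrix.mul_assoc _ (L.map _)]
    rw [← Matrix.mul_assoc, this, Matrix.mul_nonsing_inv_cancel_right _ _ (isUnit_det_pencil _)]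
  rw [transferMatrix_eq A, Matrix.mul_add, ← Matrix.mul_assoc, hC, transferMatrix_eq,
    transferMatrix_eq, map_C_add, map_C_one, map_C_mul]
  simp only [Matrix.mul_add, Matrix.add_mul, Matrix.one_mul, Matrix.mul_assoc]
  abel

end Transfer

end

/-! ### Para-Hermitian conjugation: a sum `∑ f_j f_j^*` admits no cancellation on the axis or at
infinity. -/

section

open Polynomial

section Scalar

theorem coeff_paraConjPoly (p : ℂ[X]) (n : ℕ) :
    (paraConjPoly p).coeff n = (-1) ^ n * starRingEnd ℂ (p.coeff n) := by
  have : (-X : ℂ[X]) = C (-1) * X := by simp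
  simp only [paraConjPoly, RingHom.coe_comp, Function.comp_apply, coe_mapRingHom,
    coe_compRingHom_apply]
  rw [this, comp_C_mul_X_coeff, coeff_map, mul_comm]

theorem paraConjPoly_paraConjPoly (p : ℂ[X]) : paraConjPoly (paraConjPoly p) = p := by
  ext n
  rw [coeff_paraConjPoly, coeff_paraConjPoly, map_mul, Complex.conj_conj, ← mul_assoc, map_pow,
    map_neg, map_one, ← mul_pow]
  simp

theorem natDegree_paraConjPoly_le (p : ℂ[X]) : (paraConjPoly p).natDegree ≤ p.natDegree := by
  refine natDegree_le_iff_coeff_eq_zero.2 fun n hn => ?_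
  rw [coeff_paraConjPoly, coeff_eq_zero_of_natDegree_lt hn]
  simp

theorem paraConj_div (p q : ℂ[X]) :
    paraConj (algebraMap _ _ p / algebraMap _ _ q) =
      algebraMap _ _ (paraConjPoly p) / algebraMap _ _ (paraConjPoly q) :=
  RatFunc.map_apply_div paraConjPoly
    (nonZeroDivisors_le_comap_nonZeroDivisors_of_injective paraConjPoly paraConjPoly_injective) p q

theorem paraConj_algebraMap (p : ℂ[X]) :
    paraConj (algebraMap _ _ p) = algebraMap _ _ (paraConjPoly p) := by
  simpa using paraConj_div p 1

theorem paraConj_C (c : ℂ) : paraConj (RatFunc.C c) = RatFunc.C (starRingEnd ℂ c) := by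
  rw [← RatFunc.algebraMap_C, paraConj_algebraMap, ← RatFunc.algebraMap_C]
  congr 1
  simp [paraConjPoly]

theorem paraConj_X : paraConj RatFunc.X = -RatFunc.X := by
  rw [← RatFunc.algebraMap_X, paraConj_algebraMap, ← map_neg]
  congr 1
  simp [paraConjPoly]

theorem paraConj_paraConj (f : RatFunc ℂ) : paraConj (paraConj f) = f := by
  rw [← RatFunc.num_div_denom f, paraConj_div, paraConj_div, paraConjPoly_paraConjPoly,
    paraConjPoly_paraConjPoly]

theorem paraConj_mem_regularAt {α : ℂ} {f : RatFunc ℂ}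
    (hf : f ∈ regularAt (-starRingEnd ℂ α)) : paraConj f ∈ regularAt α := by
  have hd : (paraConjPoly f.denom).eval α ≠ 0 := by
    rw [paraConjPoly_eval]
    simpa [mem_regularAt] using hf
  refine mem_regularAt_of_mul (paraConjPoly f.num) _ hd ?_
  rw [← paraConj_algebraMap, ← map_mul, ← paraConj_algebraMap]
  congr 1
  rw [← eq_div_iff (by simpa using f.denom_ne_zero), RatFunc.num_div_denom]

theorem eval_paraConj {α : ℂ} {f : RatFunc ℂ} (hf : f ∈ regularAt (-starRingEnd ℂ α)) :
    (paraConj f).eval (RingHom.id ℂ) α =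
      starRingEnd ℂ (f.eval (RingHom.id ℂ) (-starRingEnd ℂ α)) := by
  have hd : (paraConjPoly f.denom).eval α ≠ 0 := by
    rw [paraConjPoly_eval]
    simpa [mem_regularAt] using hf
  have h : paraConj f * algebraMap _ _ (paraConjPoly f.denom) =
      algebraMap _ _ (paraConjPoly f.num) := by
    rw [← paraConj_algebraMap, ← map_mul, ← paraConj_algebraMap]
    congr 1
    rw [← eq_div_iff (by simpa using f.denom_ne_zero), RatFunc.num_div_denom]
  have h' := congrArg (RatFunc.eval (RingHom.id ℂ) α) h
  rw [RatFunc.eval_mul _ _ (paraConj_mem_regularAt hf) (algebraMap_mem_regularAt α _),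
    RatFunc.eval_algebraMap, RatFunc.eval_algebraMap] at h'
  simp only [Algebra.algebraMap_self, RingHom.id_apply, eval₂_id] at h'
  rw [eq_div_of_mul_eq hd h', paraConjPoly_eval, paraConjPoly_eval, ← map_div₀]
  simp [RatFunc.eval]

theorem neg_conj_axis (ω : ℝ) : -starRingEnd ℂ (ω * Complex.I) = ω * Complex.I := by simp

/-- Common denominators for a finite family of rational functions whose para-Hermitian square
sum is `g`. -/
theorem exists_common_denom {κ : Type*} [Fintype κ] (f : κ → RatFunc ℂ) (g : RatFunc ℂ)
    (h : ∑ j, f j * paraConj (f j) = g) :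
    ∃ (q : ℂ[X]) (p : κ → ℂ[X]), q ≠ 0 ∧
      (∀ j, f j * algebraMap _ _ q = algebraMap _ _ (p j)) ∧
      g.denom * ∑ j, p j * paraConjPoly (p j) = g.num * (q * paraConjPoly q) := by
  classical
  obtain ⟨⟨q, hq⟩, hp⟩ := IsLocalization.exist_integer_multiples_of_finite (nonZeroDivisors ℂ[X]) f
  choose p hp using hp
  have hp' : ∀ j, f j * algebraMap _ _ q = algebraMap _ _ (p j) := fun j => by
    rw [hp j]
    simp [Algebra.smul_def, mul_comm]
  refine ⟨q, p, nonZeroDivisors.ne_zero hq, hp', RatFunc.algebraMap_injective ℂ ?_⟩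
  have hg : g * algebraMap _ _ g.denom = algebraMap _ _ g.num := by
    rw [← eq_div_iff (by simpa using g.denom_ne_zero), RatFunc.num_div_denom]
  have hs : algebraMap ℂ[X] (RatFunc ℂ) (∑ j, p j * paraConjPoly (p j)) =
      g * (algebraMap _ _ q * paraConj (algebraMap _ _ q)) := by
    rw [map_sum, ← h, Finset.sum_mul]
    refine Finset.sum_congr rfl fun j _ => ?_
    rw [map_mul, ← paraConj_algebraMap, ← hp', map_mul]
    ring
  rw [map_mul, hs, map_mul, ← hg, map_mul, ← paraConj_algebraMap]
  ring

theorem paraConjPoly_X_sub_C {a : ℂ} (ha : -starRingEnd ℂ a = a) :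
    paraConjPoly (X - C a) = -(X - C a) := by
  simp only [paraConjPoly, RingHom.coe_comp, Function.comp_apply, coe_mapRingHom,
    coe_compRingHom_apply, Polynomial.map_sub, map_X, map_C, sub_comp, X_comp, C_comp]
  rw [← neg_eq_iff_eq_neg.2 ha.symm, C_neg]
  ring

/-- A zero of the denominator on the imaginary axis is shared by all numerators. -/
theorem dvd_of_sum_paraConjPoly {κ : Type*} [Fintype κ] {a : ℂ} (ha : -starRingEnd ℂ a = a)
    {d n q : ℂ[X]}
    (hd : d.eval a ≠ 0) (k : ℕ) (p : κ → ℂ[X])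
    (h : d * ∑ j, p j * paraConjPoly (p j) =
      n * ((X - C a) ^ k * q * paraConjPoly ((X - C a) ^ k * q)))
    (j : κ) : (X - C a) ^ k ∣ p j := by
  induction k generalizing p with
  | zero => simp
  | succ k ih =>
    -- At `a` the right side vanishes, while the left is `d(a) ∑ |p_j(a)|²` with `d(a) ≠ 0`.
    have h0 : ∀ j, (p j).eval a = 0 := by
      have he := congrArg (eval a) h
      have hs : (∑ j, p j * paraConjPoly (p j)).eval a =
          ((∑ j, Complex.normSq ((p j).eval a) : ℝ) : ℂ) := by
        rw [eval_finsetSum, Complex.ofReal_sum]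
        refine Finset.sum_congr rfl fun j _ => ?_
        rw [eval_mul, paraConjPoly_eval, ha, Complex.mul_conj]
      have hz : (∑ j, Complex.normSq ((p j).eval a) : ℝ) = 0 := by
        rw [eval_mul, hs] at he
        have : eval a (n * ((X - C a) ^ (k + 1) * q *
            paraConjPoly ((X - C a) ^ (k + 1) * q))) = 0 := by
          simp
        rw [this] at he
        exact_mod_cast (mul_eq_zero.1 he).resolve_left hd
      rw [Finset.sum_eq_zero_iff_of_nonneg fun _ _ => Complex.normSq_nonneg _] at hz
      exact fun j => Complex.normSq_eq_zero.1 (hz j (Finset.mem_univ j))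
    choose r hr using fun j => dvd_iff_isRoot.2 (h0 j)
    have hX : (X - C a) * (X - C a) ≠ 0 :=
      mul_ne_zero (X_sub_C_ne_zero _) (X_sub_C_ne_zero _)
    have := ih r (by
      -- Each side contains `(X - a)(X - a)^* = -(X - a)²`; cancelling it lowers `k` by one, and
      -- `neg_injective` absorbs the sign.
      refine mul_left_cancel₀ hX (neg_injective ?_)
      have e1 : ∑ j, p j * paraConjPoly (p j) =
          -((X - C a) * (X - C a)) *
            ∑ j, r j * paraConjPoly (r j) := by
        rw [Finset.mul_sum]
        refine Finset.sum_congr rfl fun j _ => ?_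
        rw [hr j, map_mul, paraConjPoly_X_sub_C ha]
        ring
      rw [e1, pow_succ', mul_assoc (X - C a), map_mul paraConjPoly (X - C a),
        paraConjPoly_X_sub_C ha] at h
      linear_combination h)
    rw [hr j, pow_succ']
    exact mul_dvd_mul_left _ this

/-- If `∑ f_j f_j^*` has no pole at a point of the imaginary axis, neither have the `f_j`. -/
theorem regularAt_of_sum_paraConj {κ : Type*} [Fintype κ] (ω : ℝ) (f : κ → RatFunc ℂ)
    (h : ∑ j, f j * paraConj (f j) ∈ regularAt (ω * Complex.I)) (j : κ) :
    f j ∈ regularAt (ω * Complex.I) := by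
  obtain ⟨q, p, hq, hp, he⟩ := exists_common_denom f _ rfl
  -- The whole power of `X - iω` in the common denominator is split off; it divides every numerator
  -- and cancels.
  obtain ⟨k, r, hr, hr'⟩ : ∃ k r, q = (X - C (ω * Complex.I)) ^ k * r ∧
      ¬ (X - C (ω * Complex.I)) ∣ r :=
    ⟨_, exists_eq_pow_rootMultiplicity_mul_and_not_dvd q hq (ω * Complex.I)⟩
  generalize hg : ∑ j, f j * paraConj (f j) = g at h he
  subst hr
  obtain ⟨s, hs⟩ := dvd_of_sum_paraConjPoly (neg_conj_axis ω) h k p he j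
  have hX : algebraMap ℂ[X] (RatFunc ℂ) ((X - C (ω * Complex.I)) ^ k) ≠ 0 :=
    RatFunc.algebraMap_ne_zero (pow_ne_zero k (X_sub_C_ne_zero _))
  have hfj := hp j
  rw [hs, map_mul (algebraMap ℂ[X] (RatFunc ℂ)) _ r, map_mul (algebraMap ℂ[X] (RatFunc ℂ)) _ s,
    mul_left_comm] at hfj
  have hfj' := mul_left_cancel₀ hX hfj
  have hr0 : r.eval (ω * Complex.I) ≠ 0 := fun h0 => hr' (dvd_iff_isRoot.2 h0)
  exact mem_regularAt_of_mul s r hr0 hfj'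

/-- If `∑ f_j f_j^*` is proper, so are the `f_j`. -/
theorem proper_of_sum_paraConj {κ : Type*} [Fintype κ] (f : κ → RatFunc ℂ)
    (h : ∑ j, f j * paraConj (f j) ∈ properRing) (j : κ) : f j ∈ properRing := by
  obtain ⟨q, p, hq, hp, he⟩ := exists_common_denom f _ rfl
  set g := ∑ j, f j * paraConj (f j)
  suffices hdeg : (p j).natDegree ≤ q.natDegree by
    rcases eq_or_ne (f j) 0 with h0 | h0
    · rw [h0]; exact properRing.zero_mem
    have := congrArg RatFunc.intDegree (hp j)
    rw [RatFunc.intDegree_mul h0 (by simpa using hq), RatFunc.intDegree_polynomial,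
      RatFunc.intDegree_polynomial] at this
    rw [mem_properRing]
    omega
  obtain ⟨i, -, hi⟩ := Finset.exists_max_image Finset.univ (fun j => (p j).natDegree)
    ⟨j, Finset.mem_univ j⟩
  set N := (p i).natDegree with hN
  refine (hi j (Finset.mem_univ j)).trans ?_
  rcases eq_or_ne (p i) 0 with hpi | hpi
  · simp [hN, hpi]
  -- For the maximal degree `N`, the coefficient of degree `2N` is, up to sign, a sum of squared
  -- moduli. It is therefore nonzero, and comparing degrees with `2 * q.natDegree` gives properness.
  have hcoeff : (∑ j, p j * paraConjPoly (p j)).coeff (N + N) =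
      (-1) ^ N * ((∑ j, Complex.normSq ((p j).coeff N) : ℝ) : ℂ) := by
    rw [finsetSum_coeff, Complex.ofReal_sum, Finset.mul_sum]
    refine Finset.sum_congr rfl fun j _ => ?_
    have hj := hi j (Finset.mem_univ j)
    rw [coeff_mul_add_eq_of_natDegree_le hj ((natDegree_paraConjPoly_le _).trans hj),
      coeff_paraConjPoly, ← Complex.mul_conj]
    ring
  have hne : (∑ j, p j * paraConjPoly (p j)).coeff (N + N) ≠ 0 := by
    rw [hcoeff]
    refine mul_ne_zero (by simp) (Complex.ofReal_ne_zero.2 (ne_of_gt ?_))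
    exact Finset.sum_pos' (fun _ _ => Complex.normSq_nonneg _)
      ⟨i, Finset.mem_univ i, Complex.normSq_pos.2 (leadingCoeff_ne_zero.2 hpi)⟩
  have h1 := le_natDegree_of_ne_zero hne
  have h2 := congrArg natDegree he
  rw [natDegree_mul g.denom_ne_zero (fun h0 => hne (by rw [h0, coeff_zero]))] at h2
  have h3 : (g.num * (q * paraConjPoly q)).natDegree ≤
      g.num.natDegree + (q.natDegree + q.natDegree) :=
    natDegree_mul_le_of_le le_rfl (natDegree_mul_le_of_le le_rfl (natDegree_paraConjPoly_le q))
  have h4 : g.intDegree ≤ 0 := h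
  rw [RatFunc.intDegree] at h4
  omega

end Scalar

section Matrices

variable {ι κ l : Type*}

theorem paraConjTranspose_apply (W : Matrix ι κ (RatFunc ℂ)) (i j) :
    paraConjTranspose W i j = paraConj (W j i) := rfl

theorem paraConjTranspose_mul [Fintype κ] (A : Matrix ι κ (RatFunc ℂ))
    (B : Matrix κ l (RatFunc ℂ)) :
    paraConjTranspose (A * B) = paraConjTranspose B * paraConjTranspose A := by
  rw [paraConjTranspose, Matrix.map_mul, Matrix.transpose_mul]; rfl

theorem paraConjTranspose_one [DecidableEq ι] :
    paraConjTranspose (1 : Matrix ι ι (RatFunc ℂ)) = 1 := by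
  rw [paraConjTranspose, Matrix.map_one _ (map_zero _) (map_one _), Matrix.transpose_one]

theorem paraConjTranspose_add (A B : Matrix ι κ (RatFunc ℂ)) :
    paraConjTranspose (A + B) = paraConjTranspose A + paraConjTranspose B := by
  ext i j
  simp [paraConjTranspose_apply]

theorem paraConjTranspose_C (A : Matrix ι κ ℂ) :
    paraConjTranspose (A.map RatFunc.C) = Aᴴ.map RatFunc.C := by
  ext i j
  simp [paraConjTranspose_apply, paraConj_C]

theorem paraConjTranspose_transpose (A : Matrix ι κ (RatFunc ℂ)) :
    paraConjTranspose Aᵀ = (paraConjTranspose A)ᵀ := rfl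

theorem paraConjTranspose_pencil [Fintype ι] [DecidableEq ι] (A : Matrix ι ι ℂ) :
    paraConjTranspose (pencil A) = -pencil (-Aᴴ) := by
  ext i j
  by_cases h : i = j
  · subst h
    simp [paraConjTranspose_apply, pencil, paraConj_C, paraConj_X, neg_add_eq_sub]
  · simp [paraConjTranspose_apply, pencil, paraConj_C, h, Ne.symm h]

theorem isUnit_det_paraConjTranspose [Fintype ι] [DecidableEq ι] {A : Matrix ι ι (RatFunc ℂ)}
    (h : IsUnit A.det) : IsUnit (paraConjTranspose A).det := by
  rw [paraConjTranspose, Matrix.det_transpose]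
  exact (paraConj.map_det A) ▸ h.map paraConj

theorem paraConjTranspose_inv [Fintype ι] [DecidableEq ι] {A : Matrix ι ι (RatFunc ℂ)}
    (h : IsUnit A.det) : paraConjTranspose A⁻¹ = (paraConjTranspose A)⁻¹ := by
  symm
  refine Matrix.inv_eq_left_inv ?_
  rw [← paraConjTranspose_mul, Matrix.mul_nonsing_inv _ h, paraConjTranspose_one]

theorem regularAt_of_isSpectralFactor [Fintype κ] {Φ : Matrix ι ι (RatFunc ℂ)}
    {W : Matrix ι κ (RatFunc ℂ)} (h : IsSpectralFactor Φ W) (ω : ℝ)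
    (hΦ : ¬ IsPole Φ (ω * Complex.I)) (i j) : W i j ∈ regularAt (ω * Complex.I) := by
  refine regularAt_of_sum_paraConj ω (W i) ?_ j
  have := not_isPole_iff.1 hΦ i i
  rwa [h] at this

theorem proper_of_isSpectralFactor [Fintype κ] {Φ : Matrix ι ι (RatFunc ℂ)}
    {W : Matrix ι κ (RatFunc ℂ)} (h : IsSpectralFactor Φ W)
    (hΦ : IsProper Φ) (i j) : W i j ∈ properRing := by
  refine proper_of_sum_paraConj (W i) ?_ j
  have := hΦ i i
  rwa [h] at this

/-- A spectral density is para-Hermitian. -/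
theorem IsSpectralDensity.paraConjTranspose_eq {Φ : Matrix ι ι (RatFunc ℂ)}
    (h : IsSpectralDensity Φ) : paraConjTranspose Φ = Φ := by
  have hreg : ∀ (ω : ℝ) i j, Φ i j ∈ regularAt (ω * Complex.I) := fun ω =>
    not_isPole_iff.1 (h.not_isPole ω)
  have hreg' : ∀ (ω : ℝ) i j, paraConj (Φ i j) ∈ regularAt (ω * Complex.I) := fun ω i j =>
    paraConj_mem_regularAt (by rw [neg_conj_axis]; exact hreg ω i j)
  ext i j
  rw [← sub_eq_zero]
  refine eq_zero_of_eval_axis (fun ω => sub_mem (hreg' ω j i) (hreg ω i j)) fun ω => ?_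
  have := (h.posSemidef ω).1.apply i j
  have e := map_sub (evalHom (ω * Complex.I)) ⟨_, hreg' ω j i⟩ ⟨_, hreg ω i j⟩
  refine e.trans ?_
  rw [sub_eq_zero]
  refine Eq.trans ?_ this
  refine (eval_paraConj (by rw [neg_conj_axis]; exact hreg ω j i)).trans ?_
  rw [neg_conj_axis]; rfl

end Matrices

end

/-! ### Minimal realizations, spectra and the Lyapunov equation. -/

section

open Polynomial

section Minimality

variable {ν ι κ : Type*} [Fintype ν] [DecidableEq ν]

/-- The columns of `V` form a basis of the hyperplane annihilated by `w`, and `L` extends the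
coordinate map to the whole space. -/
theorem exists_kernel_matrix {w : ν → ℂ} (hw : w ≠ 0) :
    ∃ k < Fintype.card ν, ∃ (V : Matrix ν (Fin k) ℂ) (L : Matrix (Fin k) ν ℂ),
      (∀ y, w ⬝ᵥ V *ᵥ y = 0) ∧ ∀ x, w ⬝ᵥ x = 0 → V *ᵥ (L *ᵥ x) = x := by
  let f : (ν → ℂ) →ₗ[ℂ] ℂ :=
    { toFun := fun x => w ⬝ᵥ x
      map_add' := dotProduct_add w
      map_smul' := fun c x => dotProduct_smul c w x }
  have hlt : Module.finrank ℂ (LinearMap.ker f) < Fintype.card ν := by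
    rw [← Module.finrank_fintype_fun_eq_card ℂ]
    refine Submodule.finrank_lt fun h => hw ?_
    refine dotProduct_eq_zero w fun x => ?_
    have : x ∈ LinearMap.ker f := h ▸ Submodule.mem_top
    exact this
  let e := (Module.finBasis ℂ (LinearMap.ker f)).equivFun
  obtain ⟨r, hr⟩ := (LinearMap.ker f).subtype.exists_leftInverse_of_injective
    (Submodule.ker_subtype _)
  refine ⟨_, hlt, LinearMap.toMatrix' ((LinearMap.ker f).subtype ∘ₗ e.symm.toLinearMap),
    LinearMap.toMatrix' (e.toLinearMap ∘ₗ r), fun y => ?_, fun x hx => ?_⟩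
  · rw [LinearMap.toMatrix'_mulVec]
    exact (e.symm y).2
  · rw [LinearMap.toMatrix'_mulVec, LinearMap.toMatrix'_mulVec]
    have : r x = ⟨x, hx⟩ := LinearMap.congr_fun hr ⟨x, hx⟩
    simp [this]

/-- The Popov-Belevitch-Hautus controllability test for minimal realizations. -/
theorem IsMinimalRealization.eq_zero_of_vecMul {A : Matrix ν ν ℂ} {B : Matrix ν κ ℂ}
    {C : Matrix ι ν ℂ} {D : Matrix ι κ ℂ} {T : Matrix ι κ (RatFunc ℂ)}
    (h : IsMinimalRealization A B C D T) {w : ν → ℂ} {α : ℂ} (hA : w ᵥ* A = α • w)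
    (hB : w ᵥ* B = 0) : w = 0 := by
  by_contra hw
  obtain ⟨k, hk, V, L, hV, hL⟩ := exists_kernel_matrix hw
  -- As `w` is a left eigenvector, `A` preserves the hyperplane. It also contains the columns of
  -- `B`, so the system restricts to fewer states.
  have hAV : A * V = V * (L * (A * V)) := by
    ext i j
    refine (congrFun (hL (fun i => (A * V) i j) ?_) i).symm
    have : w ⬝ᵥ A *ᵥ (V *ᵥ Pi.single j 1) = 0 := by
      rw [Matrix.dotProduct_mulVec, hA, smul_dotProduct, hV, smul_zero]
    rw [Matrix.mulVec_mulVec, Matrix.mulVec_single_one] at this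
    exact this
  have hBV : V * (L * B) = B := by
    ext i j
    exact congrFun (hL (fun i => B i j) (congrFun hB j)) i
  have := h.2 k (L * (A * V)) (L * B) (C * V) D (by
    rw [← transferMatrix_intertwine hAV, hBV, h.1])
  omega

theorem IsMinimalRealization.transpose {A : Matrix ν ν ℂ} {B : Matrix ν κ ℂ}
    {C : Matrix ι ν ℂ} {D : Matrix ι κ ℂ} {T : Matrix ι κ (RatFunc ℂ)}
    (h : IsMinimalRealization A B C D T) : IsMinimalRealization Aᵀ Cᵀ Bᵀ Dᵀ Tᵀ := by
  refine ⟨by rw [← transferMatrix_transpose, h.1], fun k A' B' C' D' h' => ?_⟩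
  refine h.2 k A'ᵀ C'ᵀ B'ᵀ D'ᵀ ?_
  rw [← transferMatrix_transpose, h', Matrix.transpose_transpose]

/-- The Popov-Belevitch-Hautus observability test for minimal realizations. -/
theorem IsMinimalRealization.eq_zero_of_mulVec {A : Matrix ν ν ℂ} {B : Matrix ν κ ℂ}
    {C : Matrix ι ν ℂ} {D : Matrix ι κ ℂ} {T : Matrix ι κ (RatFunc ℂ)}
    (h : IsMinimalRealization A B C D T) {v : ν → ℂ} {α : ℂ} (hA : A *ᵥ v = α • v)
    (hC : C *ᵥ v = 0) : v = 0 :=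
  h.transpose.eq_zero_of_vecMul (by rwa [Matrix.vecMul_transpose]) (by
    rwa [Matrix.vecMul_transpose])

end Minimality

section Spectrum

variable {ν : Type*} [Fintype ν] [DecidableEq ν]

theorem mem_spectrum_iff_exists_mulVec {A : Matrix ν ν ℂ} {α : ℂ} :
    α ∈ spectrum ℂ A ↔ ∃ v ≠ 0, A *ᵥ v = α • v := by
  rw [spectrum.mem_iff, Matrix.isUnit_iff_isUnit_det, isUnit_iff_ne_zero, not_not,
    ← Matrix.exists_mulVec_eq_zero_iff]
  refine exists_congr fun v => and_congr_right fun _ => ?_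
  rw [Matrix.sub_mulVec, sub_eq_zero, Algebra.algebraMap_eq_smul_one, Matrix.smul_mulVec,
    Matrix.one_mulVec, eq_comm]

theorem mem_spectrum_conjTranspose {A : Matrix ν ν ℂ} {α : ℂ} :
    α ∈ spectrum ℂ Aᴴ ↔ starRingEnd ℂ α ∈ spectrum ℂ A := by
  rw [← Matrix.star_eq_conjTranspose, spectrum.map_star]; rfl

theorem aeval_mul_of_intertwine {A B Y : Matrix ν ν ℂ} (h : A * Y = Y * B) (p : ℂ[X]) :
    aeval A p * Y = Y * aeval B p := by
  have hpow : ∀ n : ℕ, A ^ n * Y = Y * B ^ n := fun n => by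
    induction n with
    | zero => simp
    | succ n ih => rw [pow_succ, mul_assoc, h, ← mul_assoc, ih, mul_assoc, ← pow_succ]
  rw [aeval_eq_sum_range, aeval_eq_sum_range, Finset.sum_mul, Finset.mul_sum]
  refine Finset.sum_congr rfl fun n _ => ?_
  rw [smul_mul_assoc, hpow, mul_smul_comm]

/-- A homogeneous Sylvester equation with disjoint spectra has only the zero solution. -/
theorem eq_zero_of_intertwine {A B Y : Matrix ν ν ℂ} (h : A * Y = Y * B)
    (hAB : Disjoint (spectrum ℂ A) (spectrum ℂ B)) : Y = 0 := by
  rcases isEmpty_or_nonempty ν with _ | _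
  · exact Subsingleton.elim _ _
  have h0 := aeval_mul_of_intertwine h A.charpoly
  rw [Matrix.aeval_self_charpoly, zero_mul] at h0
  -- By spectral mapping, a zero eigenvalue here would come from a root of `A.charpoly` in the
  -- spectrum of `B`.
  have hu : IsUnit (aeval B A.charpoly) := by
    rw [← spectrum.zero_notMem_iff ℂ, spectrum.map_polynomial_aeval_of_degree_pos]
    · rintro ⟨μ, hμ, hμ0⟩
      exact Set.disjoint_left.1 hAB (Matrix.mem_spectrum_iff_isRoot_charpoly.2 hμ0) hμ
    · rw [Matrix.charpoly_degree_eq_dim]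
      exact_mod_cast Fintype.card_pos
  exact (hu.mul_left_eq_zero).1 h0.symm

/-- The Lyapunov operator of an antistable matrix. -/
theorem lyapunov_existsUnique {A : Matrix ν ν ℂ} (hA : ∀ z ∈ spectrum ℂ A, 0 < z.re)
    (Q : Matrix ν ν ℂ) : ∃! X, Aᴴ * X + X * A = Q := by
  let f : Matrix ν ν ℂ →ₗ[ℂ] Matrix ν ν ℂ :=
    LinearMap.mulLeft ℂ Aᴴ + LinearMap.mulRight ℂ A
  have hf : Function.Injective f := by
    rw [injective_iff_map_eq_zero]
    intro Y hY
    -- The homogeneous equation intertwines `Aᴴ` with `-A`, whose spectra lie in opposite open half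
    -- planes.
    refine eq_zero_of_intertwine (A := Aᴴ) (B := -A) ?_ ?_
    · rw [mul_neg]; exact eq_neg_of_add_eq_zero_left hY
    · rw [Set.disjoint_left]
      intro μ h1 h2
      have h1' := hA _ (mem_spectrum_conjTranspose.1 h1)
      rw [← spectrum.neg_eq] at h2
      have h2' := hA _ (Set.mem_neg.1 h2)
      simp only [Complex.conj_re, Complex.neg_re] at h1' h2'
      linarith
  exact Function.Bijective.existsUnique ⟨hf, LinearMap.surjective_of_injective hf⟩ Q

end Spectrum

section Lyapunov

variable {ν ι : Type*} [Fintype ν] [DecidableEq ν] [Fintype ι]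
  {A X : Matrix ν ν ℂ} {C : Matrix ι ν ℂ}

/-- `Xᴴ` solves the same equation, so uniqueness applies. -/
theorem lyapunov_isHermitian (hA : ∀ z ∈ spectrum ℂ A, 0 < z.re)
    (h : Aᴴ * X + X * A = Cᴴ * C) : X.IsHermitian := by
  refine (lyapunov_existsUnique hA (Cᴴ * C)).unique ?_ h
  have := congrArg Matrix.conjTranspose h
  rw [Matrix.conjTranspose_add, Matrix.conjTranspose_mul, Matrix.conjTranspose_mul,
    Matrix.conjTranspose_mul, Matrix.conjTranspose_conjTranspose,
    Matrix.conjTranspose_conjTranspose, add_comm] at this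
  exact this

/-- For `v ∈ ker X`, pairing the equation with `v` gives `‖C v‖² = 0`; applying it to `v` then gives
`X A v = 0`. A nonzero kernel would thus be `A`-invariant and contain an unobservable eigenvector.
-/
theorem lyapunov_isUnit (hX : X.IsHermitian) (h : Aᴴ * X + X * A = Cᴴ * C)
    (hobs : ∀ (v : ν → ℂ) (α : ℂ), A *ᵥ v = α • v → C *ᵥ v = 0 → v = 0) : IsUnit X := by
  rw [← Matrix.mulVec_injective_iff_isUnit]
  let N := LinearMap.ker X.mulVecLin
  have hC : ∀ v ∈ N, C *ᵥ v = 0 := fun v hv => by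
    have hv : X *ᵥ v = 0 := hv
    rw [← dotProduct_star_self_eq_zero, Matrix.star_mulVec,
      ← Matrix.dotProduct_mulVec, Matrix.mulVec_mulVec, ← h, Matrix.add_mulVec,
      ← Matrix.mulVec_mulVec, ← Matrix.mulVec_mulVec, hv, Matrix.mulVec_zero, zero_add,
      Matrix.dotProduct_mulVec]
    have : star v ᵥ* X = 0 := by
      rw [← hX.eq, ← Matrix.star_mulVec, hv, star_zero]
    rw [this, zero_dotProduct]
  have hN : ∀ v ∈ N, A.mulVecLin v ∈ N := fun v hv => by
    have h1 := congrArg (· *ᵥ v) h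
    have hv' : X *ᵥ v = 0 := hv
    simp only [Matrix.add_mulVec, ← Matrix.mulVec_mulVec, hv', hC v hv, Matrix.mulVec_zero,
      zero_add] at h1
    exact h1
  have hbot : N = ⊥ := by
    by_contra hne
    have : Nontrivial N := Submodule.nontrivial_iff_ne_bot.2 hne
    obtain ⟨μ, hμ⟩ := Module.End.exists_eigenvalue (A.mulVecLin.restrict hN)
    obtain ⟨v, hv⟩ := hμ.exists_hasEigenvector
    refine hv.2 (Subtype.ext (hobs v μ ?_ (hC v v.2)))
    exact congrArg Subtype.val hv.apply_eq_smul
  exact LinearMap.ker_eq_bot.1 hbot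

theorem lyapunov_closedLoop (hu : IsUnit X) (h : Aᴴ * X + X * A = Cᴴ * C) :
    X * (A + -X⁻¹ * Cᴴ * C) = -Aᴴ * X := by
  have hd := (Matrix.isUnit_iff_isUnit_det X).1 hu
  have : X * (-X⁻¹ * Cᴴ * C) = -(Cᴴ * C) := by
    rw [Matrix.neg_mul, Matrix.neg_mul, Matrix.mul_neg, Matrix.mul_assoc,
      Matrix.mul_nonsing_inv_cancel_left _ _ hd]
  rw [Matrix.mul_add, this, ← h, Matrix.neg_mul]
  abel

/-- `X` carries eigenvectors of the closed loop to eigenvectors of `-Aᴴ` with the same eigenvalue.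
-/
theorem lyapunov_stable (hu : IsUnit X) (h : Aᴴ * X + X * A = Cᴴ * C)
    (hA : ∀ z ∈ spectrum ℂ A, 0 < z.re) :
    ∀ z ∈ spectrum ℂ (A + -X⁻¹ * Cᴴ * C), z.re < 0 := by
  intro z hz
  obtain ⟨v, hv0, hv⟩ := mem_spectrum_iff_exists_mulVec.1 hz
  have h1 := congrArg (· *ᵥ v) (lyapunov_closedLoop hu h)
  simp only [← Matrix.mulVec_mulVec, hv, Matrix.mulVec_smul, Matrix.neg_mulVec] at h1
  have h2 : -z ∈ spectrum ℂ Aᴴ := by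
    refine mem_spectrum_iff_exists_mulVec.2 ⟨X *ᵥ v, fun h0 => hv0 ?_, ?_⟩
    · exact Matrix.mulVec_injective_iff_isUnit.2 hu (by simpa using h0)
    · rw [neg_smul, h1, neg_neg]
  have := hA _ (mem_spectrum_conjTranspose.1 h2)
  simpa using this

/-- The output injection built from the Lyapunov equation gives an all-pass function. -/
theorem lyapunov_allPass [DecidableEq ι] (hX : X.IsHermitian) (hu : IsUnit X)
    (h : Aᴴ * X + X * A = Cᴴ * C) :
    transferMatrix (A + -X⁻¹ * Cᴴ * C) (-X⁻¹ * Cᴴ) C 1 *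
      paraConjTranspose (transferMatrix (A + -X⁻¹ * Cᴴ * C) (-X⁻¹ * Cᴴ) C 1) = 1 := by
  have hd := (Matrix.isUnit_iff_isUnit_det X).1 hu
  set M := -X⁻¹ * Cᴴ with hM
  set F := A + M * C with hF
  have hXF : X * F = -Aᴴ * X := lyapunov_closedLoop hu h
  have hFX : -Fᴴ * X = X * A := by
    have := congrArg Matrix.conjTranspose hXF
    rw [Matrix.conjTranspose_mul, Matrix.conjTranspose_mul, hX.eq, Matrix.conjTranspose_neg,
      Matrix.conjTranspose_conjTranspose] at this
    rw [Matrix.neg_mul, this, Matrix.mul_neg, neg_neg]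
  -- The conjugate system is `[-Fᴴ | Cᴴ; -Mᴴ | 1]`, and the state change `X` turns it into `[A | -M;
  -- C | 1]`. Output injection by `M` sends the input matrix `-M` to `-M + M = 0`, leaving the
  -- constant `1`.
  have hstar : paraConjTranspose (transferMatrix F M C 1) = transferMatrix A (-M) C 1 := by
    have e : paraConjTranspose (transferMatrix F M C 1) =
        transferMatrix (-Fᴴ) Cᴴ (-Mᴴ) 1 := by
      rw [transferMatrix_eq, transferMatrix_eq, paraConjTranspose_add, paraConjTranspose_mul,
        paraConjTranspose_mul, paraConjTranspose_C, paraConjTranspose_C, paraConjTranspose_C,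
        paraConjTranspose_inv (isUnit_det_pencil F), paraConjTranspose_pencil,
        Matrix.conjTranspose_one]
      have h1 : (-pencil (-Fᴴ))⁻¹ = -(pencil (-Fᴴ))⁻¹ :=
        Matrix.inv_eq_left_inv (by
          rw [neg_mul_neg, Matrix.nonsing_inv_mul _ (isUnit_det_pencil _)])
      have h2 : (-Mᴴ).map RatFunc.C = -(Mᴴ.map RatFunc.C) := by ext; simp
      rw [h1, h2, Matrix.neg_mul, Matrix.neg_mul, Matrix.neg_mul, Matrix.mul_neg, Matrix.mul_assoc]
    have hB : X * (-M) = Cᴴ := by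
      rw [hM, Matrix.neg_mul, neg_neg, Matrix.mul_nonsing_inv_cancel_left _ _ hd]
    have hC : -Mᴴ * X = C := by
      rw [hM, Matrix.neg_mul X⁻¹, Matrix.conjTranspose_neg, neg_neg, Matrix.conjTranspose_mul,
        Matrix.conjTranspose_conjTranspose, Matrix.conjTranspose_nonsing_inv, hX.eq,
        Matrix.nonsing_inv_mul_cancel_right _ _ hd]
    rw [e, ← hB, transferMatrix_intertwine hFX, hC]
  rw [hstar, hF, outputInjection_mul]
  rw [transferMatrix_eq, Matrix.mul_one, neg_add_cancel, map_C_one]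
  simp

end Lyapunov

end

/-! ### Coprimeness of the factors produced by output injection. -/

section OutputInjection

variable {ν ι κ : Type*} [Fintype ν] [DecidableEq ν] [Fintype ι] [DecidableEq ι]

/-- The left coprime factors obtained by output injection have no common left null vector. -/
theorem IsMinimalRealization.eq_zero_of_outputInjection {A : Matrix ν ν ℂ} {B : Matrix ν κ ℂ}
    {C : Matrix ι ν ℂ} {D : Matrix ι κ ℂ} {T : Matrix ι κ (RatFunc ℂ)}
    (hmin : IsMinimalRealization A B C D T) (L : Matrix ν ι ℂ) {α : ℂ}
    (hα : α ∉ spectrum ℂ (A + L * C)) {v : ι → ℂ}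
    (h1 : v ᵥ* evalAt α (transferMatrix (A + L * C) L C 1) = 0)
    (h2 : v ᵥ* evalAt α (transferMatrix (A + L * C) (B + L * D) C D) = 0) : v = 0 := by
  have hdet : IsUnit (Matrix.scalar ν α - (A + L * C)).det :=
    (det_scalar_sub_ne_zero hα).isUnit
  rw [evalAt_transferMatrix hα] at h1 h2
  set x := v ᵥ* (C * (Matrix.scalar ν α - (A + L * C))⁻¹) with hx
  rw [Matrix.vecMul_add, ← Matrix.vecMul_vecMul, ← hx] at h1 h2
  rw [Matrix.vecMul_one] at h1
  have hxL : x ᵥ* L = -v := eq_neg_of_add_eq_zero_left h1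
  have hxF : x ᵥ* (Matrix.scalar ν α - (A + L * C)) = v ᵥ* C := by
    rw [hx, Matrix.vecMul_vecMul, Matrix.nonsing_inv_mul_cancel_right _ _ hdet]
  -- The first null condition gives `x L = -v`, so the injected term cancels `v C` and `x` is a left
  -- eigenvector of `A`. The second condition becomes `x B = 0`.
  have hxA : x ᵥ* A = α • x := by
    rw [Matrix.vecMul_sub, Matrix.vecMul_add, ← Matrix.vecMul_vecMul, hxL, Matrix.neg_vecMul] at hxF
    have : x ᵥ* Matrix.scalar ν α = α • x := by
      ext i
      simp [Matrix.scalar_apply, Matrix.vecMul_diagonal, mul_comm]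
    rw [this] at hxF
    have h3 : α • x - x ᵥ* A = 0 := by
      have : α • x - x ᵥ* A = (α • x - (x ᵥ* A + -(v ᵥ* C))) - v ᵥ* C := by abel
      rw [this, hxF, sub_self]
    exact (sub_eq_zero.1 h3).symm
  have hxB : x ᵥ* B = 0 := by
    rw [Matrix.vecMul_add, ← Matrix.vecMul_vecMul, hxL, Matrix.neg_vecMul] at h2
    simpa using h2
  have hx0 := hmin.eq_zero_of_vecMul hxA hxB
  rw [hx0, Matrix.zero_vecMul] at hxL
  exact neg_eq_zero.1 hxL.symm

end OutputInjection

/-! ### Minimum-phase factors are unique up to a unitary constant. -/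

section Uniqueness

theorem IsMinimumPhase.regular {ι κ : Type*} [Fintype κ]
    {W : Matrix ι κ (RatFunc ℂ)} (h : IsMinimumPhase W) {α : ℂ}
    (hα : 0 ≤ α.re) (i j) : W i j ∈ regularAt α :=
  not_isPole_iff.1 (fun hp => absurd (h.pole_re_neg α hp) hα.not_gt) i j

theorem IsMinimumPhase.eq_zero_of_mulVec {ι κ : Type*} [Fintype κ]
    {W : Matrix ι κ (RatFunc ℂ)} (h : IsMinimumPhase W)
    {α : ℂ} (hα : 0 < α.re) (v : κ → ℂ) (hv : evalAt α W *ᵥ v = 0) : v = 0 := by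
  by_contra hv0
  exact absurd (h.zero_re_nonpos α ⟨not_isPole_iff.2 (h.regular hα.le), v, hv0, hv⟩) hα.not_ge

variable {ι κ : Type*} [Fintype ι] [Fintype κ] [DecidableEq ι] [DecidableEq κ]

theorem exists_left_inverse {N : Matrix ι κ ℂ} (hN : ∀ v, N *ᵥ v = 0 → v = 0) :
    ∃ L : Matrix κ ι ℂ, L * N = 1 := by
  obtain ⟨g, hg⟩ := N.mulVecLin.exists_leftInverse_of_injective
    (LinearMap.ker_eq_bot'.2 hN)
  refine ⟨LinearMap.toMatrix' g, ?_⟩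
  have := congrArg LinearMap.toMatrix' hg
  rwa [LinearMap.toMatrix'_comp, LinearMap.toMatrix'_id,
    show LinearMap.toMatrix' N.mulVecLin = N from LinearMap.toMatrix'_toLin' N] at this

/-- `W₀(α)` is injective, so it has a constant left inverse `L`. Then `L W₀` is square and
invertible near `α`, and `U = (L W₀)⁻¹ L W`. -/
theorem IsMinimumPhase.quotient_regular {W₀ W : Matrix ι κ (RatFunc ℂ)}
    {U : Matrix κ κ (RatFunc ℂ)} (h₀ : IsMinimumPhase W₀) (h : IsMinimumPhase W)
    (hU : W = W₀ * U) {α : ℂ} (hα : 0 < α.re) (i j) : U i j ∈ regularAt α := by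
  obtain ⟨L, hL⟩ := exists_left_inverse (h₀.eq_zero_of_mulVec hα)
  have hZ := matrix_mul_mem (C_entries_regular α L) (h₀.regular hα.le)
  have hZα : (evalAt α (L.map RatFunc.C * W₀)).det ≠ 0 := by
    rw [evalAt_mul (C_entries_regular α L) (h₀.regular hα.le), evalAt_C, hL, Matrix.det_one]
    exact one_ne_zero
  have hUeq : U = (L.map RatFunc.C * W₀)⁻¹ * (L.map RatFunc.C * W) := by
    rw [hU, ← Matrix.mul_assoc (L.map _), Matrix.nonsing_inv_mul_cancel_left]
    exact (det_ne_zero_of_evalAt hZ hZα).isUnit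
  rw [hUeq]
  exact matrix_mul_mem (inv_regular hZ hZα)
    (matrix_mul_mem (C_entries_regular α L) (h.regular hα.le)) i j

/-- Minimum-phase matrices related by an all-pass function are related by a unitary constant. -/
theorem IsMinimumPhase.exists_unitary {W₀ W : Matrix ι κ (RatFunc ℂ)}
    {U : Matrix κ κ (RatFunc ℂ)} (h₀ : IsMinimumPhase W₀) (h : IsMinimumPhase W)
    (hU : W = W₀ * U) (hUU : U * paraConjTranspose U = 1) :
    ∃ P ∈ Matrix.unitaryGroup κ ℂ, U = P.map RatFunc.C := by
  have hU' : W₀ = W * paraConjTranspose U := by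
    rw [hU, Matrix.mul_assoc, hUU, Matrix.mul_one]
  have hfac : IsSpectralFactor 1 U := hUU.symm
  have hone : (1 : Matrix κ κ (RatFunc ℂ)) = (1 : Matrix κ κ ℂ).map RatFunc.C := map_C_one.symm
  have hreg : ∀ i j α, U i j ∈ regularAt α := by
    intro i j α
    rcases lt_trichotomy α.re 0 with hα | hα | hα
    -- The reflected point lies in the open right half plane, where exchanging the roles of `W₀` and
    -- `W` makes `U^*` regular.
    · have := h.quotient_regular h₀ hU' (α := -starRingEnd ℂ α) (by simpa using hα) j i
      have := paraConj_mem_regularAt this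
      rwa [paraConjTranspose_apply, paraConj_paraConj] at this
    · have hα' : α = α.im * Complex.I := by
        apply Complex.ext <;> simp [hα]
      rw [hα']
      refine regularAt_of_isSpectralFactor hfac _ (not_isPole_iff.2 ?_) i j
      rw [hone]
      exact C_entries_regular _ _
    · exact h₀.quotient_regular h hU hα i j
  have hprop : ∀ i j, U i j ∈ properRing :=
    proper_of_isSpectralFactor hfac (by
      rw [hone]
      exact fun i j => C_mem_properRing _)
  choose P hP using fun i j => eq_C_of_regular (hreg i j) (hprop i j)
  have hUP : U = (Matrix.of P).map RatFunc.C := by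
    ext i j : 2
    exact hP i j
  refine ⟨Matrix.of P, Matrix.mem_unitaryGroup_iff.2 (map_C_injective ?_), hUP⟩
  rw [hUP, paraConjTranspose_C, ← map_C_mul] at hUU
  exact hUU.trans map_C_one.symm

theorem IsMinimumPhase.mul_unitary {l : Type*} {W : Matrix l κ (RatFunc ℂ)} (h : IsMinimumPhase W)
    {P : Matrix κ κ ℂ} (hP : P ∈ Matrix.unitaryGroup κ ℂ) :
    IsMinimumPhase (W * P.map RatFunc.C) where
  proper := matrix_mul_mem (R := properRing) h.proper fun _ _ => C_mem_properRing _
  pole_re_neg α hα := by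
    by_contra hre
    exact not_isPole_iff.2
      (matrix_mul_mem (h.regular (not_lt.1 hre)) (C_entries_regular α P)) hα
  zero_re_nonpos α := by
    rintro ⟨-, v, hv0, hv⟩
    by_contra! hre
    rw [evalAt_mul (h.regular hre.le) (C_entries_regular α P), evalAt_C,
      ← Matrix.mulVec_mulVec] at hv
    have := congrArg (star P *ᵥ ·) (h.eq_zero_of_mulVec hre _ hv)
    simp only [Matrix.mulVec_mulVec, Matrix.mem_unitaryGroup_iff'.1 hP, Matrix.one_mulVec,
      Matrix.mulVec_zero] at this
    exact hv0 this

theorem IsSpectralFactor.mul_allPass {l : Type*} {Φ : Matrix l l (RatFunc ℂ)}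
    {W : Matrix l κ (RatFunc ℂ)} (h : IsSpectralFactor Φ W) {U : Matrix κ κ (RatFunc ℂ)}
    (hU : U * paraConjTranspose U = 1) : IsSpectralFactor Φ (W * U) := by
  rw [IsSpectralFactor, paraConjTranspose_mul, Matrix.mul_assoc, ← Matrix.mul_assoc U, hU,
    Matrix.one_mul]
  exact h

theorem map_C_mul_paraConjTranspose {P : Matrix κ κ ℂ} (hP : P ∈ Matrix.unitaryGroup κ ℂ) :
    P.map RatFunc.C * paraConjTranspose (P.map RatFunc.C) = 1 := by
  rw [paraConjTranspose_C, ← map_C_mul, ← Matrix.star_eq_conjTranspose,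
    Matrix.mem_unitaryGroup_iff.1 hP, map_C_one]

end Uniqueness

/-! ### Spectral factors in block form, and the rank condition. -/

section Blocks

theorem fromRows_mul_paraConjTranspose {m p k : Type*} [Fintype k]
    (W₁ : Matrix m k (RatFunc ℂ)) (W₂ : Matrix p k (RatFunc ℂ)) :
    Matrix.fromRows W₁ W₂ * paraConjTranspose (Matrix.fromRows W₁ W₂) =
      Matrix.fromBlocks (W₁ * paraConjTranspose W₁) (W₁ * paraConjTranspose W₂)
        (W₂ * paraConjTranspose W₁) (W₂ * paraConjTranspose W₂) := by
  have : paraConjTranspose (Matrix.fromRows W₁ W₂) =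
      Matrix.fromCols (paraConjTranspose W₁) (paraConjTranspose W₂) := by
    ext i (j | j) <;> rfl
  rw [this, Matrix.fromRows_mul_fromCols]

/-- Spectral factors with invertible leading block are related by an all-pass function. -/
theorem IsSpectralFactor.exists_allPass {m p : Type*} [Fintype m] [DecidableEq m]
    {Φ : Matrix (m ⊕ p) (m ⊕ p) (RatFunc ℂ)}
    {W₀ W : Matrix (m ⊕ p) m (RatFunc ℂ)} (h₀ : IsSpectralFactor Φ W₀)
    (h : IsSpectralFactor Φ W) (hu : IsUnit Φ.toBlocks₁₁.det) :
    ∃ U : Matrix m m (RatFunc ℂ), W = W₀ * U ∧ U * paraConjTranspose U = 1 := by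
  obtain ⟨V₁, V₂, rfl⟩ : ∃ V₁ V₂, W₀ = Matrix.fromRows V₁ V₂ :=
    ⟨_, _, (Matrix.fromRows_toRows W₀).symm⟩
  obtain ⟨W₁, W₂, rfl⟩ : ∃ W₁ W₂, W = Matrix.fromRows W₁ W₂ :=
    ⟨_, _, (Matrix.fromRows_toRows W).symm⟩
  rw [IsSpectralFactor, fromRows_mul_paraConjTranspose] at h₀ h
  have hV : Φ.toBlocks₁₁ = V₁ * paraConjTranspose V₁ := by rw [h₀, Matrix.toBlocks_fromBlocks₁₁]
  have hW : Φ.toBlocks₁₁ = W₁ * paraConjTranspose W₁ := by rw [h, Matrix.toBlocks_fromBlocks₁₁]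
  have h21 : W₂ * paraConjTranspose W₁ = V₂ * paraConjTranspose V₁ := by
    have := h.symm.trans h₀
    exact (Matrix.fromBlocks_inj.1 this).2.2.1
  have hV1 : IsUnit V₁.det := by
    rw [hV, Matrix.det_mul] at hu
    exact isUnit_of_mul_isUnit_left hu
  have hW1 : IsUnit W₁.det := by
    rw [hW, Matrix.det_mul] at hu
    exact isUnit_of_mul_isUnit_left hu
  have hVs := isUnit_det_paraConjTranspose hV1
  have hWs := isUnit_det_paraConjTranspose hW1
  have hVU : V₁ * (V₁⁻¹ * W₁) = W₁ := Matrix.mul_nonsing_inv_cancel_left _ _ hV1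
  have hUW : (V₁⁻¹ * W₁) * paraConjTranspose W₁ = paraConjTranspose V₁ := by
    rw [Matrix.mul_assoc, ← hW, hV, Matrix.nonsing_inv_mul_cancel_left _ _ hV1]
  refine ⟨V₁⁻¹ * W₁, ?_, ?_⟩
  · rw [Matrix.fromRows_mul, hVU]
    congr 1
    have : W₂ * paraConjTranspose W₁ = V₂ * (V₁⁻¹ * W₁) * paraConjTranspose W₁ := by
      rw [h21, Matrix.mul_assoc V₂, hUW]
    rw [← Matrix.mul_nonsing_inv_cancel_right _ W₂ hWs, this,
      Matrix.mul_nonsing_inv_cancel_right _ _ hWs]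
  · rw [paraConjTranspose_mul, ← Matrix.mul_assoc, hUW, paraConjTranspose_inv hV1,
      Matrix.mul_nonsing_inv _ hVs]

variable {m p : Type*} [Fintype m] [Fintype p] [DecidableEq m]

theorem isUnit_of_rank {K : Type*} [Field K] {A : Matrix m m K}
    (h : A.rank = Fintype.card m) : IsUnit A := by
  rw [← Matrix.mulVec_surjective_iff_isUnit]
  have : LinearMap.range A.mulVecLin = ⊤ := Submodule.eq_top_of_finrank_eq (by
    rw [Module.finrank_fintype_fun_eq_card]
    exact h)
  exact LinearMap.range_eq_top.1 this

/-- If the rank of a block matrix is that of its invertible corner, the Schur complement is zero. -/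
theorem schur_eq_zero_of_rank {K : Type*} [Field K] {A : Matrix m m K} {B : Matrix m p K}
    {C : Matrix p m K} {D : Matrix p p K} (hA : IsUnit A.det)
    (h : (Matrix.fromBlocks A B C D).rank = Fintype.card m) : D = C * A⁻¹ * B := by
  classical
  set N := Matrix.fromBlocks A B C D with hN
  -- The top coordinates map the range onto a space of the same dimension, so a range vector with
  -- zero top part is zero. The vector `z` below has zero top part, and its bottom part is the Schur
  -- complement applied to `y`.
  let g : LinearMap.range N.mulVecLin →ₗ[K] (m → K) :=
    LinearMap.funLeft K K Sum.inl ∘ₗ (LinearMap.range N.mulVecLin).subtype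
  have hsurj : Function.Surjective g := fun a => by
    refine ⟨⟨_, Sum.elim (A⁻¹ *ᵥ a) 0, rfl⟩, ?_⟩
    ext i
    simp [g, LinearMap.funLeft_apply, hN, Matrix.fromBlocks_mulVec,
      Matrix.mul_nonsing_inv _ hA]
  have hinj : Function.Injective g :=
    (LinearMap.injective_iff_surjective_of_finrank_eq_finrank (by
      rw [Module.finrank_fintype_fun_eq_card]; exact h)).2 hsurj
  rw [← sub_eq_zero]
  refine Matrix.toLin'.injective (LinearMap.ext fun y => ?_)
  let z : LinearMap.range N.mulVecLin := ⟨_, Sum.elim (-(A⁻¹ *ᵥ (B *ᵥ y))) y, rfl⟩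
  have hz : g z = 0 := by
    ext i
    simp [g, z, LinearMap.funLeft_apply, hN, Matrix.fromBlocks_mulVec, Matrix.mulVec_neg,
      Matrix.mulVec_mulVec, Matrix.mul_nonsing_inv_cancel_left _ _ hA]
  have hz0 : z = 0 := hinj (hz.trans (map_zero g).symm)
  have := congrArg (fun f : m ⊕ p → K => f ∘ Sum.inr) (congrArg Subtype.val hz0)
  simp only [z, hN, Matrix.mulVecLin_apply, Matrix.fromBlocks_mulVec] at this
  ext i
  have := congrFun this i
  simpa [Matrix.sub_mulVec, Matrix.mulVec_neg, Matrix.mulVec_mulVec, sub_eq_neg_add,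
    Matrix.mul_assoc] using this

/-- The full-rank factor `[G; H G]` of a spectral density whose rank is that of its corner. -/
theorem isSpectralFactor_fromRows [DecidableEq p] {Φ : Matrix (m ⊕ p) (m ⊕ p) (RatFunc ℂ)}
    (hΦ : paraConjTranspose Φ = Φ) (hrank : Φ.rank = Fintype.card m)
    (hu : IsUnit Φ.toBlocks₁₁.det) {G : Matrix m m (RatFunc ℂ)}
    (hG : IsSpectralFactor Φ.toBlocks₁₁ G) :
    IsSpectralFactor Φ (Matrix.fromRows G (Φ.toBlocks₂₁ * Φ.toBlocks₁₁⁻¹ * G)) := by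
  obtain ⟨A, B, C, D, rfl⟩ : ∃ A B C D, Φ = Matrix.fromBlocks A B C D :=
    ⟨_, _, _, _, (Matrix.fromBlocks_toBlocks Φ).symm⟩
  simp only [Matrix.toBlocks_fromBlocks₁₁, Matrix.toBlocks_fromBlocks₂₁] at *
  have hD := schur_eq_zero_of_rank hu hrank
  have hconj : paraConjTranspose (Matrix.fromBlocks A B C D) =
      Matrix.fromBlocks (paraConjTranspose A) (paraConjTranspose C) (paraConjTranspose B)
        (paraConjTranspose D) := by
    ext (i | i) (j | j) <;> rfl
  rw [hconj] at hΦ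
  obtain ⟨hA, hC, -, -⟩ := Matrix.fromBlocks_inj.1 hΦ
  have hG' : A = G * paraConjTranspose G := hG
  have hAC : A * paraConjTranspose (C * A⁻¹) = B := by
    rw [paraConjTranspose_mul, paraConjTranspose_inv hu, hA, hC,
      Matrix.mul_nonsing_inv_cancel_left _ _ hu]
  rw [IsSpectralFactor, fromRows_mul_paraConjTranspose, paraConjTranspose_mul,
    ← Matrix.mul_assoc G, ← hG', hAC, Matrix.mul_assoc _ G, Matrix.mul_assoc _ G,
    ← Matrix.mul_assoc G, ← hG', hAC, Matrix.nonsing_inv_mul_cancel_right _ _ hu, ← hD]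

end Blocks

/-! ### Block-triangular realizations and the injection `[M; 0]`. -/

theorem spectrum_fromBlocks_zero₂₁ {a b : Type*} [Fintype a] [Fintype b] [DecidableEq a]
    [DecidableEq b] (A : Matrix a a ℂ) (B : Matrix a b ℂ) (D : Matrix b b ℂ) :
    spectrum ℂ (Matrix.fromBlocks A B 0 D) = spectrum ℂ A ∪ spectrum ℂ D := by
  ext z
  simp [Matrix.mem_spectrum_iff_isRoot_charpoly, Matrix.charpoly_fromBlocks_zero₂₁]

theorem closedLoop_fromBlocks {m nu ns : Type*} [Fintype m] (Au : Matrix nu nu ℂ)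
    (Aus : Matrix nu ns ℂ) (As : Matrix ns ns ℂ)
    (Cu : Matrix m nu ℂ) (Cs : Matrix m ns ℂ) (M : Matrix nu m ℂ) :
    Matrix.fromBlocks (Au + M * Cu) (Aus + M * Cs) 0 As =
      Matrix.fromBlocks Au Aus 0 As + Matrix.fromRows M 0 * Matrix.fromCols Cu Cs := by
  rw [Matrix.fromRows_mul_fromCols, Matrix.fromBlocks_add]
  simp

/-- The input `[M; 0]` never reaches the `As` states, so they drop out. -/
theorem transferMatrix_fromBlocks_fromRows_zero {nu ns κ ι : Type*} [Fintype nu] [Fintype ns]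
    [DecidableEq nu] [DecidableEq ns] (F : Matrix nu nu ℂ) (E : Matrix nu ns ℂ)
    (As : Matrix ns ns ℂ) (M : Matrix nu κ ℂ) (Cu : Matrix ι nu ℂ) (Cs : Matrix ι ns ℂ)
    (D : Matrix ι κ ℂ) :
    transferMatrix (Matrix.fromBlocks F E 0 As) (Matrix.fromRows M 0) (Matrix.fromCols Cu Cs) D =
      transferMatrix F M Cu D := by
  have hV : Matrix.fromBlocks F E 0 As *
      Matrix.fromRows (1 : Matrix nu nu ℂ) (0 : Matrix ns nu ℂ) =
      Matrix.fromRows (1 : Matrix nu nu ℂ) (0 : Matrix ns nu ℂ) * F := by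
    rw [Matrix.fromBlocks_mul_fromRows, Matrix.fromRows_mul]
    simp
  have hM : Matrix.fromRows M (0 : Matrix ns κ ℂ) =
      Matrix.fromRows (1 : Matrix nu nu ℂ) (0 : Matrix ns nu ℂ) * M := by
    rw [Matrix.fromRows_mul]
    simp
  have hC : Matrix.fromCols Cu Cs * Matrix.fromRows (1 : Matrix nu nu ℂ) (0 : Matrix ns nu ℂ) =
      Cu := by
    rw [Matrix.fromCols_mul_fromRows]
    simp
  rw [hM, transferMatrix_intertwine hV, hC]

/-- The coprime numerator is the product of the all-pass denominator and the transfer matrix. -/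
theorem coprimeFactor_mul {m p nu ns : Type*} [Fintype m] [Fintype nu] [Fintype ns]
    [DecidableEq m] [DecidableEq nu] [DecidableEq ns] {Au : Matrix nu nu ℂ}
    {Aus : Matrix nu ns ℂ} {As : Matrix ns ns ℂ}
    {Bu : Matrix nu p ℂ} {Bs : Matrix ns p ℂ} {Cu : Matrix m nu ℂ} {Cs : Matrix m ns ℂ}
    {D : Matrix m p ℂ} (M : Matrix nu m ℂ) :
    transferMatrix (Au + M * Cu) M Cu 1 *
      transferMatrix (Matrix.fromBlocks Au Aus 0 As) (Matrix.fromRows Bu Bs)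
        (Matrix.fromCols Cu Cs) D =
      transferMatrix (Matrix.fromBlocks (Au + M * Cu) (Aus + M * Cs) 0 As)
        (Matrix.fromRows (Bu + M * D) Bs) (Matrix.fromCols Cu Cs) D := by
  have hB : Matrix.fromRows (Bu + M * D) Bs =
      Matrix.fromRows Bu Bs + Matrix.fromRows M 0 * D := by
    rw [Matrix.fromRows_mul]
    ext (i | i) j <;> simp
  rw [← transferMatrix_fromBlocks_fromRows_zero (Au + M * Cu) (Aus + M * Cs) As M Cu Cs 1,
    closedLoop_fromBlocks, outputInjection_mul, hB]

/-! ### The constructed factor is minimum-phase. -/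

section Main

variable {m p nu ns : Type*} [Fintype m] [Fintype nu] [Fintype ns]
  [DecidableEq m] [DecidableEq nu] [DecidableEq ns]

/-- The minimum-phase factor given by the coprime factorization with all-pass denominator. -/
theorem isMinimumPhase_fromRows {Φ : Matrix (m ⊕ p) (m ⊕ p) (RatFunc ℂ)}
    (hΦ : IsSpectralDensity Φ) {G : Matrix m m (RatFunc ℂ)} (hG : IsMinimumPhase G)
    {Au : Matrix nu nu ℂ} {Aus : Matrix nu ns ℂ} {As : Matrix ns ns ℂ}
    {Bu : Matrix nu p ℂ} {Bs : Matrix ns p ℂ} {Cu : Matrix m nu ℂ} {Cs : Matrix m ns ℂ}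
    {D : Matrix m p ℂ} {T : Matrix m p (RatFunc ℂ)}
    (hreal : IsMinimalRealization (Matrix.fromBlocks Au Aus 0 As) (Matrix.fromRows Bu Bs)
      (Matrix.fromCols Cu Cs) D T)
    (hAs : ∀ z ∈ spectrum ℂ As, z.re ≤ 0) {M : Matrix nu m ℂ}
    (hF : ∀ z ∈ spectrum ℂ (Au + M * Cu), z.re < 0)
    {W : Matrix (m ⊕ p) m (RatFunc ℂ)} (hWΦ : IsSpectralFactor Φ W)
    (hW : W = Matrix.fromRows (G * (transferMatrix (Au + M * Cu) M Cu 1)ᵀ)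
      (transferMatrix (Matrix.fromBlocks (Au + M * Cu) (Aus + M * Cs) 0 As)
        (Matrix.fromRows (Bu + M * D) Bs) (Matrix.fromCols Cu Cs) D)ᵀ) :
    IsMinimumPhase W := by
  have hKspec : ∀ {z : ℂ}, 0 ≤ z.re → z ∉ spectrum ℂ (Au + M * Cu) := fun hz hz' =>
    absurd (hF _ hz') hz.not_gt
  have hspec : ∀ {z : ℂ}, 0 < z.re →
      z ∉ spectrum ℂ (Matrix.fromBlocks (Au + M * Cu) (Aus + M * Cs) 0 As) := by
    intro z hz hz'
    rw [spectrum_fromBlocks_zero₂₁] at hz'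
    exact hz'.elim (hKspec hz.le) fun h => absurd (hAs _ h) hz.not_ge
  have hreg : ∀ {α : ℂ}, 0 ≤ α.re → ∀ i j, W i j ∈ regularAt α := by
    intro α hα
    -- On the axis `As` may have eigenvalues, so regularity there comes from `Φ = W W^*`, not from
    -- the realization.
    rcases hα.eq_or_lt with h0 | hpos
    · have hα' : α = α.im * Complex.I := by
        apply Complex.ext <;> simp [← h0]
      rw [hα']
      exact regularAt_of_isSpectralFactor hWΦ _ (hΦ.not_isPole _)
    · rw [hW]
      rintro (i | i) j
      · exact matrix_mul_mem (hG.regular hα)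
          (fun i j => transferMatrix_regular (hKspec hα) M Cu 1 j i) i j
      · exact transferMatrix_regular (hspec hpos) _ _ _ j i
  refine ⟨?_, fun s hs => ?_, fun α => ?_⟩
  · rw [hW]
    rintro (i | i) j
    · exact matrix_mul_mem (R := properRing) hG.proper
        (fun i j => transferMatrix_proper _ M Cu 1 j i) i j
    · exact transferMatrix_proper _ _ _ _ j i
  · by_contra hre
    exact not_isPole_iff.2 (hreg (not_lt.1 hre)) hs
  · rintro ⟨-, v, hv0, hv⟩
    by_contra! hre
    refine hv0 ?_
    have hsplit : evalAt α W = Matrix.fromRows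
        (evalAt α (G * (transferMatrix (Au + M * Cu) M Cu 1)ᵀ))
        (evalAt α (transferMatrix (Matrix.fromBlocks (Au + M * Cu) (Aus + M * Cs) 0 As)
          (Matrix.fromRows (Bu + M * D) Bs) (Matrix.fromCols Cu Cs) D)ᵀ) := by
      rw [hW]
      ext (i | i) j <;> rfl
    rw [hsplit, Matrix.fromRows_mulVec] at hv
    have htop := congrArg (fun f : m ⊕ p → ℂ => f ∘ Sum.inl) hv
    have hbot := congrArg (fun f : m ⊕ p → ℂ => f ∘ Sum.inr) hv
    simp only [Sum.elim_comp_inl, Sum.elim_comp_inr] at htop hbot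
    rw [evalAt_mul (B := (transferMatrix (Au + M * Cu) M Cu 1)ᵀ) (hG.regular hre.le)
      (fun i j => transferMatrix_regular (hKspec hre.le) M Cu 1 j i),
      ← Matrix.mulVec_mulVec] at htop
    have hK := hG.eq_zero_of_mulVec hre _ htop
    have hB : Matrix.fromRows (Bu + M * D) Bs =
        Matrix.fromRows Bu Bs + Matrix.fromRows M 0 * D := by
      rw [Matrix.fromRows_mul]
      ext (i | i) j <;> simp
    have hα := hspec hre
    rw [closedLoop_fromBlocks] at hα
    refine hreal.eq_zero_of_outputInjection (Matrix.fromRows M 0) hα ?_ ?_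
    · rw [← closedLoop_fromBlocks, transferMatrix_fromBlocks_fromRows_zero,
        ← Matrix.mulVec_transpose]
      exact hK
    · rw [← closedLoop_fromBlocks, ← hB, ← Matrix.mulVec_transpose]
      exact hbot

end Main

end SpectralFactorization
end

/-! ### Assembly of the parametrization. -/

open SpectralFactorization in
theorem theorem5p2 {m p nu ns : ℕ}
    (Φ : Matrix (Fin m ⊕ Fin p) (Fin m ⊕ Fin p) (RatFunc ℂ))
    (hΦ : SpectralFactorization.IsSpectralDensity Φ)
    (hrank : Φ.rank = m)
    (hrank₁₁ : Φ.toBlocks₁₁.rank = m)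
    (G₁ : Matrix (Fin m) (Fin m) (RatFunc ℂ))
    (hG₁ : SpectralFactorization.IsMinimumPhase G₁)
    (hG₁Φ : SpectralFactorization.IsSpectralFactor Φ.toBlocks₁₁ G₁)
    (H : Matrix (Fin p) (Fin m) (RatFunc ℂ))
    (hH : H = Φ.toBlocks₂₁ * Φ.toBlocks₁₁⁻¹)
    (Au : Matrix (Fin nu) (Fin nu) ℂ) (Aus : Matrix (Fin nu) (Fin ns) ℂ)
    (As : Matrix (Fin ns) (Fin ns) ℂ)
    (Bu : Matrix (Fin nu) (Fin p) ℂ) (Bs : Matrix (Fin ns) (Fin p) ℂ)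
    (Cu : Matrix (Fin m) (Fin nu) ℂ) (Cs : Matrix (Fin m) (Fin ns) ℂ)
    (D : Matrix (Fin m) (Fin p) ℂ)
    (hreal : SpectralFactorization.IsMinimalRealization
      (Matrix.fromBlocks Au Aus 0 As) (Matrix.fromRows Bu Bs) (Matrix.fromCols Cu Cs) D
      (G₁ᵀ * Hᵀ))
    (hAu : ∀ z ∈ spectrum ℂ Au, 0 < z.re)
    (hAs : ∀ z ∈ spectrum ℂ As, z.re ≤ 0) :
    ∃ X : Matrix (Fin nu) (Fin nu) ℂ,
      (Auᴴ * X + X * Au - Cuᴴ * Cu = 0 ∧ X.IsHermitian ∧ IsUnit X) ∧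
      (∀ Y : Matrix (Fin nu) (Fin nu) ℂ, Auᴴ * Y + Y * Au - Cuᴴ * Cu = 0 → Y = X) ∧
      ∃ M : Matrix (Fin nu) (Fin m) ℂ, M = -X⁻¹ * Cuᴴ ∧
        ∀ W : Matrix (Fin m ⊕ Fin p) (Fin m) (RatFunc ℂ),
          (SpectralFactorization.IsSpectralFactor Φ W ∧ W.rank = m ∧
              SpectralFactorization.IsMinimumPhase W) ↔
            ∃ P ∈ Matrix.unitaryGroup (Fin m) ℂ,
              ∃ (Q₁ : Matrix (Fin m) (Fin m) (RatFunc ℂ))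
                (W₂ : Matrix (Fin p) (Fin m) (RatFunc ℂ)),
                Q₁ = (SpectralFactorization.transferMatrix (Au + M * Cu) M (P * Cu) P)ᵀ ∧
                W₂ = (SpectralFactorization.transferMatrix
                  (Matrix.fromBlocks (Au + M * Cu) (Aus + M * Cs) 0 As)
                  (Matrix.fromRows (Bu + M * D) Bs)
                  (Matrix.fromCols (P * Cu) (P * Cs)) (P * D))ᵀ ∧
                W = Matrix.fromRows (G₁ * Q₁) W₂ := by
  obtain ⟨X, hX, hXuniq⟩ := lyapunov_existsUnique hAu (Cuᴴ * Cu)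
  have hXH := lyapunov_isHermitian hAu hX
  have hXu : IsUnit X := by
    refine lyapunov_isUnit hXH hX fun v α hA hC => ?_
    -- Padding by zero makes an unobservable eigenvector of `Au` one of the whole block-triangular
    -- realization.
    have h0 : Sum.elim v (0 : Fin ns → ℂ) = 0 := by
      refine hreal.eq_zero_of_mulVec (α := α) ?_ ?_
      · rw [Matrix.fromBlocks_mulVec]
        ext (i | i) <;> simp [hA]
      · rw [Matrix.fromCols_mulVec]
        simp [hC]
    exact funext fun i => congrFun h0 (Sum.inl i)
  refine ⟨X, ⟨sub_eq_zero.2 hX, hXH, hXu⟩, fun Y hY => hXuniq Y (sub_eq_zero.1 hY),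
    -X⁻¹ * Cuᴴ, rfl, ?_⟩
  have hF := lyapunov_stable hXu hX hAu
  have hKK := lyapunov_allPass hXH hXu hX
  set M := -X⁻¹ * Cuᴴ
  set K := transferMatrix (Au + M * Cu) M Cu 1 with hK
  set N := transferMatrix (Matrix.fromBlocks (Au + M * Cu) (Aus + M * Cs) 0 As)
    (Matrix.fromRows (Bu + M * D) Bs) (Matrix.fromCols Cu Cs) D with hN
  have hu : IsUnit Φ.toBlocks₁₁.det := (Matrix.isUnit_iff_isUnit_det _).1
    (isUnit_of_rank (hrank₁₁.trans (Fintype.card_fin m).symm))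
  have hW₀rows : Matrix.fromRows (G₁ * Kᵀ) Nᵀ = Matrix.fromRows G₁ (H * G₁) * Kᵀ := by
    rw [Matrix.fromRows_mul, hN, ← coprimeFactor_mul, hreal.1]
    simp only [Matrix.transpose_mul, Matrix.transpose_transpose, hK]
  have hKK' : Kᵀ * paraConjTranspose Kᵀ = 1 := by
    rw [paraConjTranspose_transpose, ← Matrix.transpose_mul, mul_eq_one_comm.1 hKK,
      Matrix.transpose_one]
  have hW₀Φ : IsSpectralFactor Φ (Matrix.fromRows (G₁ * Kᵀ) Nᵀ) := by
    rw [hW₀rows, hH]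
    exact (isSpectralFactor_fromRows hΦ.paraConjTranspose_eq
      (hrank.trans (Fintype.card_fin m).symm) hu hG₁Φ).mul_allPass hKK'
  have hW₀ : IsMinimumPhase (Matrix.fromRows (G₁ * Kᵀ) Nᵀ) :=
    isMinimumPhase_fromRows hΦ hG₁ hreal hAs hF hW₀Φ rfl
  -- `P` multiplies the realizations on the left, so after transposition it acts on `W₀` from the
  -- right as `Pᵀ`.
  have hparam : ∀ P : Matrix (Fin m) (Fin m) ℂ,
      Matrix.fromRows (G₁ * (transferMatrix (Au + M * Cu) M (P * Cu) P)ᵀ)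
        (transferMatrix (Matrix.fromBlocks (Au + M * Cu) (Aus + M * Cs) 0 As)
          (Matrix.fromRows (Bu + M * D) Bs) (Matrix.fromCols (P * Cu) (P * Cs)) (P * D))ᵀ =
        Matrix.fromRows (G₁ * Kᵀ) Nᵀ * Pᵀ.map RatFunc.C := fun P => by
    have h1 := mul_transferMatrix P (Au + M * Cu) M Cu 1
    rw [Matrix.mul_one] at h1
    rw [h1, ← Matrix.mul_fromCols, mul_transferMatrix, ← hK, ← hN, Matrix.fromRows_mul,
      Matrix.transpose_mul, Matrix.transpose_mul, Matrix.transpose_map, Matrix.mul_assoc]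
  have htrans : ∀ P ∈ Matrix.unitaryGroup (Fin m) ℂ, Pᵀ ∈ Matrix.unitaryGroup (Fin m) ℂ := by
    intro P hP
    rw [Matrix.mem_unitaryGroup_iff]
    change Pᵀ * (star P)ᵀ = 1
    rw [← Matrix.transpose_mul, Matrix.mem_unitaryGroup_iff'.1 hP, Matrix.transpose_one]
  intro W
  constructor
  · rintro ⟨hWΦ, -, hW⟩
    obtain ⟨U, hWU, hUU⟩ := hW₀Φ.exists_allPass hWΦ hu
    obtain ⟨P, hP, rfl⟩ := hW₀.exists_unitary hW hWU hUU
    exact ⟨Pᵀ, htrans P hP, _, _, rfl, rfl, by rw [hparam, Matrix.transpose_transpose, hWU]⟩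
  · rintro ⟨P, hP, _, _, rfl, rfl, rfl⟩
    rw [hparam]
    have hfac := hW₀Φ.mul_allPass (map_C_mul_paraConjTranspose (htrans P hP))
    refine ⟨hfac, le_antisymm
      ((Matrix.rank_le_card_width _).trans_eq (Fintype.card_fin m)) ?_,
      hW₀.mul_unitary (htrans P hP)⟩
    -- The lower bound is `m = rank Φ = rank (W W^*) ≤ rank W`.
    have hle := Matrix.rank_mul_le_left (Matrix.fromRows (G₁ * Kᵀ) Nᵀ * Pᵀ.map RatFunc.C)
      (paraConjTranspose (Matrix.fromRows (G₁ * Kᵀ) Nᵀ * Pᵀ.map RatFunc.C))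
    exact hrank.symm.le.trans ((congrArg Matrix.rank hfac).le.trans hle)
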